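/- **Theorem (quasi-optimality for inhomogeneous boundary data).** Let $d\ge 2$, let $\Omega\subset\mathbb R^d$ be a bounded domain with Lipschitz boundary and outward unit normal $n$, and write $\operatorname{tr}$ for the trace on $\partial\Omega$, $\|\cdot\|$ and $\langle\cdot,\cdot\rangle$ for the norm and inner product of $L^2(\Omega)$. Put $L^2_0(\Omega)=\{q\in L^2(\Omega):\int_\Omega q\,dx=0\}$ and $H^1_\sim(\Omega)=\{v\in H^1(\Omega)^d:\int_{\partial\Omega}\operatorname{tr}(v)\cdot n\,d\sigma=0\}$. Let $\nu>0$, $f\in H^{-1}(\Omega)^d$, $g\in H^1_\sim(\Omega)$, and let $(u,p)\in H^1_\sim(\Omega)\times L^2_0(\Omega)$ be the weak solution of the Stokes problem, i.e. $\nu\langle\nabla u,\nabla v\rangle-\langle p,\operatorname{div}v\rangle=\langle f,v\rangle$ for all $v\in H^1_0(\Omega)^d$, $\langle\operatorname{div}u,q\rangle=0$ for all $q\in L^2_0(\Omega)$, and $\operatorname{tr}(u)=\operatorname{tr}(g)$ (so that $\operatorname{div}u=0$). Let $(\mathcal T_h)_h$ be a shape-regular sequence of conforming triangulations of $\overline\Omega$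 into closed $d$-simplices (in particular $\Omega$ is polyhedral), let $k\in\mathbb N$, and define the Scott–Vogelius spaces $$X_h=\{v\in C(\overline\Omega)^d: v|_T\in\mathcal P_k(T)^d\ \ \forall T\in\mathcal T_h\},\quad V_h=X_h\cap H^1_0(\Omega)^d,\quad X_{h,\sim}=X_h\cap H^1_\sim(\Omega),\quad Q_h=\operatorname{div}X_{h,\sim}.$$ Assume that * (inf-sup stability) there is $\overline\beta>0$ with $\overline\beta\,\|q_h\|\le\sup_{v_h\in V_h\setminus\{0\}}\langle\operatorname{div}v_h,q_h\rangle/\|\nabla v_h\|$ for all $q_h\in Q_h$ and all $h$; * $\operatorname{div}V_h=\operatorname{div}X_{h,\sim}$ for all $h$. Let $I_h,\Pi_h\colon H^1(\Omega)^d\to X_h$ be linear operators such that, with constants $c_I,c_F>0$ independent of $h$ and for all $h$ and all $v\in H^1(\Omega)^d$: * $\operatorname{tr}(v)\in\operatorname{tr}(X_h)$ implies $\operatorname{tr}(I_hv)=\operatorname{tr}(v)$; $\int_{\partial\Omega}(v-I_hv)\cdot n\,d\sigma=0$; and $\|\nabla I_hv\|\le c_I\|\nabla v\|$; * $\langle\operatorname{div}\Pi_hv,q_h\rangle=\langle\operatorname{div}v,q_h\rangle$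 for all $q_h\in Q_h$; $\|\nabla\Pi_hv\|\le c_F\|\nabla v\|$; $\operatorname{tr}(v)\in\operatorname{tr}(X_h)$ implies $\operatorname{tr}(\Pi_hv)=\operatorname{tr}(v)$; and $\Pi_h(H^1_\sim(\Omega))\subset X_{h,\sim}$. Let $g_h\in X_h$ satisfy $\operatorname{tr}(g_h)=\operatorname{tr}(I_hg)=\operatorname{tr}(\Pi_hg)$, and let $(u_h,p_h)\in X_h\times Q_h$ solve the discrete problem: $\nu\langle\nabla u_h,\nabla v_h\rangle-\langle p_h,\operatorname{div}v_h\rangle=\langle f,v_h\rangle$ for all $v_h\in V_h$, $\langle\operatorname{div}u_h,q_h\rangle=0$ for all $q_h\in Q_h$, and $\operatorname{tr}(u_h)=\operatorname{tr}(g_h)$. Then for every $h$ one has $g_h\in X_{h,\sim}$, $u_h\in X_{h,\sim}$ and $\operatorname{div}u_h=0$, and $$\|\nabla u-\nabla u_h\|\le 2(1+c_F)\inf_{v_h\in X_h}\|\nabla u-\nabla v_h\|,$$ $$\overline\beta\,\nu^{-1}\|p-p_h\|\le 2(1+c_F)\inf_{v_h\in X_h}\|\nabla u-\nabla v_h\|+\overline\beta\,\nu^{-1}\inf_{q_h\in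 Q_h}\|p-q_h\|.$$ -/

import Mathlib

open MeasureTheory Set Filter Topology
open scoped ContDiff RealInnerProductSpace

noncomputable section

namespace ScottVogelius

/-- The Euclidean space `ℝ^d`. -/
abbrev Vec (d : ℕ) : Type := EuclideanSpace ℝ (Fin d)

/-- `d × d` matrices with the Frobenius norm and inner product. -/
abbrev Mat (d : ℕ) : Type := EuclideanSpace ℝ (Fin d × Fin d)

/-! ### Lipschitz domains and their boundary -/

/-- `Ω` has a Lipschitz boundary: near every boundary point, and with respect to a suitable
direction `e`, the set `Ω` is the strict epigraph of a Lipschitz function of the coordinates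
orthogonal to `e`. -/
def HasLipschitzBoundary {d : ℕ} (Ω : Set (Vec d)) : Prop :=
  ∀ x ∈ frontier Ω, ∃ (e : Vec d) (K : NNReal) (γ : Vec d → ℝ) (r : ℝ),
    ‖e‖ = 1 ∧ LipschitzWith K γ ∧ 0 < r ∧
      ∀ y ∈ Metric.ball x r, (y ∈ Ω ↔ γ ((ℝ ∙ e)ᗮ.starProjection y) < ⟪e, y⟫)

/-- A bounded domain (nonempty, open, connected) with Lipschitz boundary. -/
structure IsLipschitzDomain {d : ℕ} (Ω : Set (Vec d)) : Prop where
  isOpen : IsOpen Ω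
  isConnected : IsConnected Ω
  isBounded : Bornology.IsBounded Ω
  lipschitz : HasLipschitzBoundary Ω

/-- The surface measure on `∂Ω`: the `(d-1)`-dimensional Hausdorff measure (normalised to agree
with Lebesgue measure on `ℝ^(d-1)`) restricted to `∂Ω`. -/
def surfaceMeasure {d : ℕ} (Ω : Set (Vec d)) : Measure (Vec d) :=
  (Measure.euclideanHausdorffMeasure (d - 1)).restrict (frontier Ω)

/-- `n` is the outward unit normal to `Ω` at `x`: `Ω` is tangent at `x` to the half space
`{y | ⟪y - x, n⟫ < 0}`. -/
def IsOutwardNormal {d : ℕ} (Ω : Set (Vec d)) (x n : Vec d) : Prop :=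
  ‖n‖ = 1 ∧ ∀ ε > (0 : ℝ), ∀ᶠ y in 𝓝 x,
    (⟪y - x, n⟫ < -(ε * ‖y - x‖) → y ∈ Ω) ∧ (ε * ‖y - x‖ < ⟪y - x, n⟫ → y ∉ Ω)

open Classical in
/-- The outward unit normal; it exists at almost every boundary point of a Lipschitz domain, and
the value `0` is used elsewhere. -/
def outwardNormal {d : ℕ} (Ω : Set (Vec d)) (x : Vec d) : Vec d :=
  if h : ∃ n, IsOutwardNormal Ω x n then h.choose else 0

/-! ### Lebesgue and Sobolev spaces -/

/-- `L²(Ω)`. -/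
abbrev L2 {d : ℕ} (Ω : Set (Vec d)) : Type := Lp ℝ 2 (volume.restrict Ω)

/-- `L²(Ω)^d`. -/
abbrev L2Vec {d : ℕ} (Ω : Set (Vec d)) : Type := Lp (Vec d) 2 (volume.restrict Ω)

/-- `L²(Ω)^(d × d)`. -/
abbrev L2Mat {d : ℕ} (Ω : Set (Vec d)) : Type := Lp (Mat d) 2 (volume.restrict Ω)

/-- `L²_0(Ω)`: the square integrable functions with vanishing mean. -/
def L20 {d : ℕ} (Ω : Set (Vec d)) : Set (L2 Ω) := {q | ∫ x in Ω, q x = 0}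

/-- The partial derivative `∂_j φ`. -/
def partialDeriv {d : ℕ} (φ : Vec d → ℝ) (j : Fin d) (x : Vec d) : ℝ :=
  fderiv ℝ φ x (EuclideanSpace.single j 1)

/-- `G` is the weak gradient of the vector field `v` in `Ω`, with entries `G (i, j) = ∂_j v_i`. -/
def IsWeakGradient {d : ℕ} (Ω : Set (Vec d)) (v : Vec d → Vec d) (G : Vec d → Mat d) : Prop :=
  ∀ φ : Vec d → ℝ, ContDiff ℝ ∞ φ → HasCompactSupport φ → tsupport φ ⊆ Ω → ∀ i j : Fin d,
    ∫ x in Ω, v x i * partialDeriv φ j x = -∫ x in Ω, G x (i, j) * φ x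

lemma integrable_coord_mul {d : ℕ} {ι : Type} [Fintype ι] {Ω : Set (Vec d)}
    (v : Lp (EuclideanSpace ℝ ι) 2 (volume.restrict Ω)) (i : ι) {ψ : Vec d → ℝ}
    (hψ : Continuous ψ) (hc : HasCompactSupport ψ) :
    Integrable (fun x => v x i * ψ x) (volume.restrict Ω) := by
  have h1 : MemLp (fun x => v x i) 2 (volume.restrict Ω) :=
    (EuclideanSpace.proj (𝕜 := ℝ) i).comp_memLp' (Lp.memLp v)
  have h2 : MemLp ψ 2 (volume.restrict Ω) := (hψ.memLp_of_hasCompactSupport hc).restrict Ω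
  exact h1.integrable_mul h2

lemma continuous_partialDeriv {d : ℕ} {φ : Vec d → ℝ} (h : ContDiff ℝ ∞ φ) (j : Fin d) :
    Continuous (partialDeriv φ j) :=
  (h.continuous_fderiv (by simp)).clm_apply continuous_const

lemma hasCompactSupport_partialDeriv {d : ℕ} {φ : Vec d → ℝ} (h : HasCompactSupport φ)
    (j : Fin d) : HasCompactSupport (partialDeriv φ j) :=
  h.fderiv_apply ℝ _

/-- `H¹(Ω)^d`, realised as the space of pairs `(v, ∇v)` of a square integrable vector field and its
square integrable weak gradient, with the norm `(‖v‖² + ‖∇v‖²)^(1/2)`. -/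
def H1 {d : ℕ} (Ω : Set (Vec d)) : Submodule ℝ (WithLp 2 (L2Vec Ω × L2Mat Ω)) where
  carrier := {w | IsWeakGradient Ω w.fst w.snd}
  zero_mem' := by
    intro φ _ _ _ i j
    have h1 : (fun x => ((0 : WithLp 2 (L2Vec Ω × L2Mat Ω)).fst) x i * partialDeriv φ j x)
        =ᵐ[volume.restrict Ω] 0 := by
      filter_upwards [Lp.coeFn_zero (Vec d) 2 (volume.restrict Ω)] with x hx
      rw [show (0 : WithLp 2 (L2Vec Ω × L2Mat Ω)).fst = 0 from rfl, hx]
      simp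
    have h2 : (fun x => ((0 : WithLp 2 (L2Vec Ω × L2Mat Ω)).snd) x (i, j) * φ x)
        =ᵐ[volume.restrict Ω] 0 := by
      filter_upwards [Lp.coeFn_zero (Mat d) 2 (volume.restrict Ω)] with x hx
      rw [show (0 : WithLp 2 (L2Vec Ω × L2Mat Ω)).snd = 0 from rfl, hx]
      simp
    rw [integral_congr_ae h1, integral_congr_ae h2]
    simp
  add_mem' := by
    intro a b ha hb φ hφ hc hs i j
    have h1 : (fun x => ((a + b).fst) x i * partialDeriv φ j x) =ᵐ[volume.restrict Ω]
        fun x => a.fst x i * partialDeriv φ j x + b.fst x i * partialDeriv φ j x := by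
      filter_upwards [Lp.coeFn_add a.fst b.fst] with x hx
      rw [WithLp.add_fst, hx, Pi.add_apply, PiLp.add_apply, add_mul]
    have h2 : (fun x => ((a + b).snd) x (i, j) * φ x) =ᵐ[volume.restrict Ω]
        fun x => a.snd x (i, j) * φ x + b.snd x (i, j) * φ x := by
      filter_upwards [Lp.coeFn_add a.snd b.snd] with x hx
      rw [WithLp.add_snd, hx, Pi.add_apply, PiLp.add_apply, add_mul]
    rw [integral_congr_ae h1, integral_congr_ae h2, integral_add, integral_add,
      ha φ hφ hc hs i j, hb φ hφ hc hs i j]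
    · ring
    · exact integrable_coord_mul _ _ hφ.continuous hc
    · exact integrable_coord_mul _ _ hφ.continuous hc
    · exact integrable_coord_mul _ _ (continuous_partialDeriv hφ j)
        (hasCompactSupport_partialDeriv hc j)
    · exact integrable_coord_mul _ _ (continuous_partialDeriv hφ j)
        (hasCompactSupport_partialDeriv hc j)
  smul_mem' := by
    intro c a ha φ hφ hc hs i j
    have h1 : (fun x => ((c • a).fst) x i * partialDeriv φ j x) =ᵐ[volume.restrict Ω]
        fun x => c * (a.fst x i * partialDeriv φ j x) := by
      filter_upwards [Lp.coeFn_smul c a.fst] with x hx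
      rw [WithLp.smul_fst, hx, Pi.smul_apply, PiLp.smul_apply, smul_eq_mul, mul_assoc]
    have h2 : (fun x => ((c • a).snd) x (i, j) * φ x) =ᵐ[volume.restrict Ω]
        fun x => c * (a.snd x (i, j) * φ x) := by
      filter_upwards [Lp.coeFn_smul c a.snd] with x hx
      rw [WithLp.smul_snd, hx, Pi.smul_apply, PiLp.smul_apply, smul_eq_mul, mul_assoc]
    rw [integral_congr_ae h1, integral_congr_ae h2, integral_const_mul, integral_const_mul,
      ha φ hφ hc hs i j]
    ring

/-- The vector field underlying an element of `H¹(Ω)^d`. -/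
def toField {d : ℕ} {Ω : Set (Vec d)} (v : H1 Ω) : L2Vec Ω :=
  (v : WithLp 2 (L2Vec Ω × L2Mat Ω)).fst

/-- The weak gradient `∇ : H¹(Ω)^d → L²(Ω)^(d × d)`. -/
def grad {d : ℕ} {Ω : Set (Vec d)} : H1 Ω →ₗ[ℝ] L2Mat Ω :=
  (WithLp.sndₗ 2 ℝ (L2Vec Ω) (L2Mat Ω)) ∘ₗ (H1 Ω).subtype

/-- The trace of a matrix, as a continuous linear functional. -/
def matTrace (d : ℕ) : Mat d →L[ℝ] ℝ := ∑ i : Fin d, EuclideanSpace.proj (i, i)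

/-- The divergence `div v = ∑ i, ∂_i v_i`, as a map `H¹(Ω)^d → L²(Ω)`. -/
def divg {d : ℕ} {Ω : Set (Vec d)} : H1 Ω →ₗ[ℝ] L2 Ω :=
  ((matTrace d).compLpL 2 (volume.restrict Ω)).toLinearMap ∘ₗ grad

/-- The smooth vector fields with compact support in `Ω`, as elements of `H¹(Ω)^d`. -/
def testFields {d : ℕ} (Ω : Set (Vec d)) : Submodule ℝ (H1 Ω) where
  carrier := {v | ∃ φ : Vec d → Vec d, ContDiff ℝ ∞ φ ∧ HasCompactSupport φ ∧ tsupport φ ⊆ Ω ∧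
    toField v =ᵐ[volume.restrict Ω] φ}
  zero_mem' := ⟨0, contDiff_const, HasCompactSupport.zero, by simp,
    Lp.coeFn_zero (Vec d) 2 (volume.restrict Ω)⟩
  add_mem' := by
    rintro a b ⟨φ, h1, h2, h3, h4⟩ ⟨ψ, k1, k2, k3, k4⟩
    refine ⟨φ + ψ, h1.add k1, h2.add k2,
      (tsupport_add φ ψ).trans (union_subset h3 k3), ?_⟩
    filter_upwards [h4, k4, Lp.coeFn_add (toField a) (toField b)] with x hx kx h
    exact h.trans (by simp [hx, kx])
  smul_mem' := by
    rintro c a ⟨φ, h1, h2, h3, h4⟩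
    refine ⟨c • φ, contDiff_const.smul h1, h2.smul_left (f := fun _ => c),
      (closure_mono (Function.support_const_smul_subset c φ)).trans h3, ?_⟩
    filter_upwards [h4, Lp.coeFn_smul c (toField a)] with x hx h
    exact h.trans (by simp [hx])

/-- `H¹_0(Ω)^d`: the closure of the test fields in the `H¹` norm. -/
def H10 {d : ℕ} (Ω : Set (Vec d)) : Submodule ℝ (H1 Ω) := (testFields Ω).topologicalClosure

/-! ### Traces -/

/-- `τ` is the trace of `v` on `∂Ω`: at almost every boundary point `x` (with respect to the surface
measure), the mean of `|v - τ(x)|` over `B(x, r) ∩ Ω` tends to `0` as `r → 0`. On a Lipschitz domain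
every `v ∈ H¹(Ω)^d` has such a trace, and it agrees with the continuous extension of the
restriction map; for `v` continuous up to the boundary it is the restriction of `v` to `∂Ω`. -/
def HasTrace {d : ℕ} (Ω : Set (Vec d)) (v : H1 Ω) (τ : Vec d → Vec d) : Prop :=
  ∀ᵐ x ∂(surfaceMeasure Ω),
    Tendsto (fun r : ℝ => ⨍ y in Metric.ball x r ∩ Ω, ‖toField v y - τ x‖) (𝓝[>] 0) (𝓝 0)

/-- `tr v = tr w`. -/
def SameTrace {d : ℕ} (Ω : Set (Vec d)) (v w : H1 Ω) : Prop :=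
  ∃ τ : Vec d → Vec d, HasTrace Ω v τ ∧ HasTrace Ω w τ

/-- `H¹_∼(Ω)`: the fields in `H¹(Ω)^d` with `∫_{∂Ω} tr v · n dσ = 0`. -/
def H1sim {d : ℕ} (Ω : Set (Vec d)) : Set (H1 Ω) :=
  {v | ∃ τ : Vec d → Vec d, HasTrace Ω v τ ∧
    Integrable (fun x => ⟪τ x, outwardNormal Ω x⟫) (surfaceMeasure Ω) ∧
    ∫ x, ⟪τ x, outwardNormal Ω x⟫ ∂(surfaceMeasure Ω) = 0}

/-! ### Triangulations and finite element spaces -/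

/-- A conforming triangulation of the closure of `Ω` into closed `d`-simplices. A simplex is given
by the set of its `d + 1` vertices, and two simplices meet in the (possibly empty) common face
spanned by their common vertices. -/
structure Triangulation {d : ℕ} (Ω : Set (Vec d)) where
  cells : Finset (Finset (Vec d))
  card_eq : ∀ T ∈ cells, T.card = d + 1
  affineIndependent : ∀ T ∈ cells, AffineIndependent ℝ (fun z : T => (z : Vec d))
  cover : ⋃ T ∈ cells, convexHull ℝ (T : Set (Vec d)) = closure Ω
  conforming : ∀ T ∈ cells, ∀ T' ∈ cells,
    convexHull ℝ (T : Set (Vec d)) ∩ convexHull ℝ (T' : Set (Vec d)) =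
      convexHull ℝ ((T : Set (Vec d)) ∩ (T' : Set (Vec d)))

/-- The diameter `h_T` of a simplex. -/
def simplexDiam {d : ℕ} (T : Finset (Vec d)) : ℝ := Metric.diam (convexHull ℝ (T : Set (Vec d)))

/-- The radius `ρ_T` of the largest ball inscribed in a simplex. -/
def inradius {d : ℕ} (T : Finset (Vec d)) : ℝ :=
  sSup {r : ℝ | 0 ≤ r ∧ ∃ x, Metric.closedBall x r ⊆ convexHull ℝ (T : Set (Vec d))}

/-- Shape regularity of a sequence of triangulations. -/
def ShapeRegular {d : ℕ} {Ω : Set (Vec d)} (𝒯 : ℕ → Triangulation Ω) : Prop :=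
  ∃ χ > (0 : ℝ), ∀ i, ∀ T ∈ (𝒯 i).cells, χ * simplexDiam T ≤ inradius T

/-- The velocity space `X_h`: continuous vector fields on the closure of `Ω` whose components are
polynomials of degree at most `k` on each simplex. -/
def velocitySpace {d : ℕ} {Ω : Set (Vec d)} (𝒯 : Triangulation Ω) (k : ℕ) :
    Submodule ℝ (H1 Ω) where
  carrier := {v | ∃ W : Vec d → Vec d, ContinuousOn W (closure Ω) ∧
    toField v =ᵐ[volume.restrict Ω] W ∧
    ∀ T ∈ 𝒯.cells, ∀ i : Fin d, ∃ P : MvPolynomial (Fin d) ℝ, P.totalDegree ≤ k ∧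
      ∀ x ∈ convexHull ℝ (T : Set (Vec d)), W x i = P.eval (fun j => x j)}
  zero_mem' := ⟨0, continuousOn_const, Lp.coeFn_zero (Vec d) 2 (volume.restrict Ω),
    fun _ _ _ => ⟨0, by simp, by simp⟩⟩
  add_mem' := by
    rintro a b ⟨V, h1, h2, h3⟩ ⟨W, k1, k2, k3⟩
    refine ⟨V + W, h1.add k1, ?_, fun T hT i => ?_⟩
    · filter_upwards [h2, k2, Lp.coeFn_add (toField a) (toField b)] with x hx kx h
      exact h.trans (by simp [hx, kx])
    · obtain ⟨P, hP, hP'⟩ := h3 T hT i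
      obtain ⟨Q, hQ, hQ'⟩ := k3 T hT i
      exact ⟨P + Q, (MvPolynomial.totalDegree_add P Q).trans (max_le hP hQ),
        fun x hx => by simp [hP' x hx, hQ' x hx]⟩
  smul_mem' := by
    rintro c a ⟨V, h1, h2, h3⟩
    refine ⟨c • V, h1.const_smul c, ?_, fun T hT i => ?_⟩
    · filter_upwards [h2, Lp.coeFn_smul c (toField a)] with x hx h
      exact h.trans (by simp [hx])
    · obtain ⟨P, hP, hP'⟩ := h3 T hT i
      exact ⟨c • P, (MvPolynomial.totalDegree_smul_le c P).trans hP,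
        fun x hx => by simp [hP' x hx]⟩

/-- `V_h = X_h ∩ H¹_0(Ω)^d`. -/
def velocitySpaceZero {d : ℕ} {Ω : Set (Vec d)} (𝒯 : Triangulation Ω) (k : ℕ) :
    Submodule ℝ (H1 Ω) :=
  velocitySpace 𝒯 k ⊓ H10 Ω

/-- `X_{h,∼} = X_h ∩ H¹_∼(Ω)`. -/
def velocitySpaceSim {d : ℕ} {Ω : Set (Vec d)} (𝒯 : Triangulation Ω) (k : ℕ) : Set (H1 Ω) :=
  {v | v ∈ velocitySpace 𝒯 k ∧ v ∈ H1sim Ω}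

/-- The pressure space `Q_h = div X_{h,∼}`. -/
def pressureSpace {d : ℕ} {Ω : Set (Vec d)} (𝒯 : Triangulation Ω) (k : ℕ) : Set (L2 Ω) :=
  divg '' velocitySpaceSim 𝒯 k

/-- `X_{h,∼,div}`: the elements of `X_{h,∼}` whose divergence is orthogonal to `Q_h`. -/
def velocitySpaceSimDiv {d : ℕ} {Ω : Set (Vec d)} (𝒯 : Triangulation Ω) (k : ℕ) : Set (H1 Ω) :=
  {v | v ∈ velocitySpaceSim 𝒯 k ∧ ∀ q ∈ pressureSpace 𝒯 k, ⟪divg v, q⟫ = 0}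

/-- The discrete inf-sup condition for the pair `(V_h, Q_h)` with constant `β`. -/
def InfSup {d : ℕ} {Ω : Set (Vec d)} (𝒯 : Triangulation Ω) (k : ℕ) (β : ℝ) : Prop :=
  ∀ q ∈ pressureSpace 𝒯 k,
    β * ‖q‖ ≤ ⨆ v : {v : H1 Ω // v ∈ velocitySpaceZero 𝒯 k ∧ v ≠ 0},
      ⟪divg (v : H1 Ω), q⟫ / ‖grad (v : H1 Ω)‖

/-- `tr v ∈ tr X_h`. -/
def HasDiscreteTrace {d : ℕ} {Ω : Set (Vec d)} (𝒯 : Triangulation Ω) (k : ℕ) (v : H1 Ω) : Prop :=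
  ∃ w ∈ velocitySpace 𝒯 k, SameTrace Ω v w

/-- `Π : H¹(Ω)^d → X_h` is a trace preserving Fortin operator with stability constant `c`. -/
structure IsFortin {d : ℕ} {Ω : Set (Vec d)} (𝒯 : Triangulation Ω) (k : ℕ)
    (P : H1 Ω →ₗ[ℝ] velocitySpace 𝒯 k) (c : ℝ) : Prop where
  div_preserving : ∀ v, ∀ q ∈ pressureSpace 𝒯 k, ⟪divg (P v : H1 Ω), q⟫ = ⟪divg v, q⟫
  stable : ∀ v, ‖grad (P v : H1 Ω)‖ ≤ c * ‖grad v‖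
  trace_preserving : ∀ v, HasDiscreteTrace 𝒯 k v → SameTrace Ω (P v : H1 Ω) v
  mean_preserving : ∀ v ∈ H1sim Ω, (P v : H1 Ω) ∈ H1sim Ω

/-- `I : H¹(Ω)^d → X_h` is a trace preserving quasi-interpolation operator with stability
constant `c`. -/
structure IsQuasiInterpolation {d : ℕ} {Ω : Set (Vec d)} (𝒯 : Triangulation Ω) (k : ℕ)
    (I : H1 Ω →ₗ[ℝ] velocitySpace 𝒯 k) (c : ℝ) : Prop where
  trace_preserving : ∀ v, HasDiscreteTrace 𝒯 k v → SameTrace Ω (I v : H1 Ω) v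
  flux_preserving : ∀ v, v - (I v : H1 Ω) ∈ H1sim Ω
  stable : ∀ v, ‖grad (I v : H1 Ω)‖ ≤ c * ‖grad v‖

/-! ### The Stokes problem -/

/-- `(u, p) ∈ H¹_∼(Ω) × L²_0(Ω)` is the weak solution of `-ν Δu + ∇p = f`, `div u = 0` in `Ω`,
`tr u = tr g` on `∂Ω`, where `f ∈ H⁻¹(Ω)^d`. -/
structure IsWeakSolution {d : ℕ} (Ω : Set (Vec d)) (ν : ℝ) (f : H10 Ω →L[ℝ] ℝ) (g : H1 Ω)
    (u : H1 Ω) (p : L2 Ω) : Prop where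
  mem_sim : u ∈ H1sim Ω
  mem_L20 : p ∈ L20 Ω
  momentum : ∀ v : H10 Ω, ν * ⟪grad u, grad (v : H1 Ω)⟫ - ⟪p, divg (v : H1 Ω)⟫ = f v
  mass : ∀ q ∈ L20 Ω, ⟪divg u, q⟫ = 0
  boundary : SameTrace Ω u g

/-- `(u, p) ∈ X_h × Q_h` solves the discrete Stokes problem with boundary datum `g`. -/
structure IsDiscreteSolution {d : ℕ} {Ω : Set (Vec d)} (𝒯 : Triangulation Ω) (k : ℕ) (ν : ℝ)
    (f : H10 Ω →L[ℝ] ℝ) (g : H1 Ω) (u : H1 Ω) (p : L2 Ω) : Prop where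
  mem_velocity : u ∈ velocitySpace 𝒯 k
  mem_pressure : p ∈ pressureSpace 𝒯 k
  momentum : ∀ v : H10 Ω, (v : H1 Ω) ∈ velocitySpaceZero 𝒯 k →
    ν * ⟪grad u, grad (v : H1 Ω)⟫ - ⟪p, divg (v : H1 Ω)⟫ = f v
  mass : ∀ q ∈ pressureSpace 𝒯 k, ⟪divg u, q⟫ = 0
  boundary : SameTrace Ω u g

end ScottVogelius

end

open ScottVogelius

noncomputable section

namespace ScottVogelius

variable {d : ℕ} {Ω : Set (Vec d)}

/-! ### Calculus of traces -/

/-! Fix a discrete v and put z = Πu + (v - Πv) = v + Π(u - v). This field is divergence-free: Πu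
lies in X_{h,∼}, and v - Πv lies in V_h because Π preserves the trace of v, so both divergences lie
in Q_h = div V_h; the Fortin property, together with the mass equation for u, makes both orthogonal
to Q_h. It also has the trace of u_h: u - g has zero trace, hence so has Π(u - g), and tr u_h = tr
g_h = tr Πg. So u_h - z is a divergence-free element of V_h, the pressures drop out of the error
equation, and ∇(u - u_h) ⊥ ∇(u_h - z). With e = u - v, ‖∇(u - u_h)‖ ≤ ‖∇(u - z)‖ = ‖∇(e - Πe)‖ ≤ (1
+ c_F)‖∇e‖ (`norm_grad_sub_le`).

For the pressure, let s be the L² projection of p onto the closure of Q_h. Since p - s is orthogonal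
to div V_h, the error equation and the inf-sup condition bound β‖p_h - s‖ by ν‖∇(u - u_h)‖, and the
triangle inequality finishes (`norm_pressure_sub_le`).

The analytic work is `mem_H10_of_hasTrace_zero`: zero trace must imply membership in the closure of
the test fields. The surface measure charges every ball centred on ∂Ω, so the continuous
representative vanishes on all of ∂Ω. Its extension by zero is piecewise Lipschitz, hence Lipschitz
(`lipschitzWith_of_finite_closed_cover`), and a Lipschitz field vanishing off Ω is an H¹ limit of
cut-off mollifications (`mem_H10_of_lipschitz`). -/

lemma toField_sub_ae (v w : H1 Ω) :
    toField (v - w) =ᵐ[volume.restrict Ω] fun x => toField v x - toField w x :=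
  Lp.coeFn_sub (toField v) (toField w)

lemma toField_zero_ae : toField (0 : H1 Ω) =ᵐ[volume.restrict Ω] fun _ => 0 :=
  Lp.coeFn_zero (Vec d) 2 (volume.restrict Ω)

lemma isFiniteMeasure_restrict (hb : Bornology.IsBounded Ω) :
    IsFiniteMeasure (volume.restrict Ω) :=
  ⟨by simpa using hb.measure_lt_top⟩

lemma integrable_toField (hb : Bornology.IsBounded Ω) (v : H1 Ω) :
    Integrable (toField v) (volume.restrict Ω) := by
  have := isFiniteMeasure_restrict hb
  exact (Lp.memLp (toField v)).integrable (by norm_num)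

lemma integrableOn_toField_sub_const (hb : Bornology.IsBounded Ω) (v : H1 Ω) (c : Vec d)
    (s : Set (Vec d)) :
    IntegrableOn (fun y => ‖toField v y - c‖) (s ∩ Ω) := by
  have := isFiniteMeasure_restrict hb
  exact IntegrableOn.mono_set (t := Ω)
    ((integrable_toField hb v).sub (integrable_const c)).norm inter_subset_right

lemma ae_restrict_inter {p : Vec d → Prop} (h : ∀ᵐ x ∂volume.restrict Ω, p x) (s : Set (Vec d)) :
    ∀ᵐ x ∂volume.restrict (s ∩ Ω), p x :=
  ae_mono (Measure.restrict_mono inter_subset_right le_rfl) h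

lemma HasTrace.sub (hb : Bornology.IsBounded Ω) {v w : H1 Ω} {τ σ : Vec d → Vec d}
    (hv : HasTrace Ω v τ) (hw : HasTrace Ω w σ) : HasTrace Ω (v - w) (τ - σ) := by
  filter_upwards [hv, hw] with x h1 h2
  refine squeeze_zero (fun r => ?_) (fun r => ?_) (by simpa using h1.add h2)
  · rw [setAverage_eq]
    exact smul_nonneg (by positivity) (integral_nonneg fun _ => norm_nonneg _)
  · rw [setAverage_eq, setAverage_eq, setAverage_eq, ← smul_add, ← integral_add
      (integrableOn_toField_sub_const hb v _ _) (integrableOn_toField_sub_const hb w _ _)]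
    refine smul_le_smul_of_nonneg_left (integral_mono_ae
      (integrableOn_toField_sub_const hb (v - w) _ _)
      ((integrableOn_toField_sub_const hb v _ _).add (integrableOn_toField_sub_const hb w _ _)) ?_)
      (by positivity)
    filter_upwards [ae_restrict_inter (toField_sub_ae v w) (Metric.ball x r)] with y hy
    simp only [hy, Pi.sub_apply]
    rw [sub_sub_sub_comm]
    exact norm_sub_le _ _

lemma hasTrace_zero : HasTrace Ω (0 : H1 Ω) 0 := by
  refine Eventually.of_forall fun x => tendsto_const_nhds.congr fun r => ?_
  rw [setAverage_eq, integral_eq_zero_of_ae, smul_zero]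
  filter_upwards [ae_restrict_inter toField_zero_ae (Metric.ball x r)] with y hy
  simp [hy]

lemma HasTrace.add (hb : Bornology.IsBounded Ω) {v w : H1 Ω} {τ σ : Vec d → Vec d}
    (hv : HasTrace Ω v τ) (hw : HasTrace Ω w σ) : HasTrace Ω (v + w) (τ + σ) := by
  simpa using hv.sub hb (hasTrace_zero.sub hb hw)

lemma measure_ball_inter_pos (ho : IsOpen Ω) {x : Vec d} (hx : x ∈ closure Ω) {r : ℝ}
    (hr : 0 < r) : 0 < volume (Metric.ball x r ∩ Ω) :=
  (Metric.isOpen_ball.inter ho).measure_pos volume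
    (mem_closure_iff.1 hx _ Metric.isOpen_ball (Metric.mem_ball_self hr))

lemma ae_surfaceMeasure_mem_frontier : ∀ᵐ x ∂(surfaceMeasure Ω), x ∈ frontier Ω :=
  ae_restrict_mem isClosed_frontier.measurableSet

/-- A ball around a boundary point meets the open set Ω in positive measure, so the mean of the
constant ‖τ x‖ over the intersection is ‖τ x‖ itself and not the default value 0. This is what makes
traces unique. -/
lemma HasTrace.ae_eq_zero (ho : IsOpen Ω) (hb : Bornology.IsBounded Ω)
    {τ : Vec d → Vec d} (h : HasTrace Ω 0 τ) : ∀ᵐ x ∂(surfaceMeasure Ω), τ x = 0 := by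
  filter_upwards [h, ae_surfaceMeasure_mem_frontier] with x hx hxf
  have key : ∀ᶠ r in 𝓝[>] (0 : ℝ),
      ⨍ y in Metric.ball x r ∩ Ω, ‖toField (0 : H1 Ω) y - τ x‖ = ‖τ x‖ := by
    filter_upwards [self_mem_nhdsWithin] with r hr
    rw [← setAverage_const (μ := volume)
      (measure_ball_inter_pos ho (frontier_subset_closure hxf) hr).ne'
      (hb.subset inter_subset_right).measure_lt_top.ne ‖τ x‖]
    refine average_congr ?_
    filter_upwards [ae_restrict_inter toField_zero_ae (Metric.ball x r)] with y hy
    simp [hy]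
  have := tendsto_nhds_unique (hx.congr' key) tendsto_const_nhds
  simpa using this.symm

lemma HasTrace.unique (ho : IsOpen Ω) (hb : Bornology.IsBounded Ω) {v : H1 Ω}
    {τ σ : Vec d → Vec d} (h : HasTrace Ω v τ) (h' : HasTrace Ω v σ) :
    τ =ᵐ[surfaceMeasure Ω] σ := by
  have := h.sub hb h'
  rw [sub_self] at this
  filter_upwards [this.ae_eq_zero ho hb] with x hx
  simpa [sub_eq_zero] using hx

lemma SameTrace.hasTrace_sub (hb : Bornology.IsBounded Ω) {v w : H1 Ω} (h : SameTrace Ω v w) :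
    HasTrace Ω (v - w) 0 := by
  obtain ⟨τ, h1, h2⟩ := h
  simpa using h1.sub hb h2

/-- Membership in `H¹_∼(Ω)` depends only on the trace. -/
lemma SameTrace.mem_H1sim (ho : IsOpen Ω) (hb : Bornology.IsBounded Ω) {v w : H1 Ω}
    (h : SameTrace Ω v w) (hw : w ∈ H1sim Ω) : v ∈ H1sim Ω := by
  obtain ⟨τ, h1, h2⟩ := h
  obtain ⟨σ, h3, hi, h0⟩ := hw
  have hae : (fun x => ⟪σ x, outwardNormal Ω x⟫) =ᵐ[surfaceMeasure Ω]
      fun x => ⟪τ x, outwardNormal Ω x⟫ := by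
    filter_upwards [h3.unique ho hb h2] with x hx
    rw [hx]
  exact ⟨τ, h1, hi.congr hae, by rw [← integral_congr_ae hae, h0]⟩

/-- A field that is continuous up to the boundary has its restriction as trace. -/
lemma hasTrace_of_continuousOn {v : H1 Ω} {W : Vec d → Vec d} (hb : Bornology.IsBounded Ω)
    (hW : ContinuousOn W (closure Ω)) (hv : toField v =ᵐ[volume.restrict Ω] W) :
    HasTrace Ω v W := by
  filter_upwards [ae_surfaceMeasure_mem_frontier] with x hxf
  rw [Metric.tendsto_nhds]
  intro ε hε
  obtain ⟨δ, hδ, h⟩ := Metric.continuousWithinAt_iff.1 (hW x (frontier_subset_closure hxf))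
    (ε / 2) (half_pos hε)
  filter_upwards [Ioo_mem_nhdsGT hδ] with r hr
  have hfin : volume (Metric.ball x r ∩ Ω) < ⊤ := (hb.subset inter_subset_right).measure_lt_top
  have hle : ‖∫ y in Metric.ball x r ∩ Ω, ‖toField v y - W x‖‖ ≤
      ε / 2 * volume.real (Metric.ball x r ∩ Ω) := by
    refine norm_setIntegral_le_of_norm_le_const_ae hfin ?_
    have hmem : ∀ᵐ y ∂volume.restrict (Metric.ball x r ∩ Ω), y ∈ Metric.ball x r := by
      rw [inter_comm]
      exact ae_mono (Measure.restrict_mono inter_subset_right le_rfl)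
        (ae_restrict_mem measurableSet_ball)
    have hmem' : ∀ᵐ y ∂volume.restrict (Metric.ball x r ∩ Ω), y ∈ closure Ω :=
      ae_mono (Measure.restrict_mono (inter_subset_right.trans subset_closure) le_rfl)
        (ae_restrict_mem isClosed_closure.measurableSet)
    filter_upwards [ae_restrict_inter hv (Metric.ball x r), hmem, hmem'] with y hy hy1 hy2
    rw [hy, norm_norm, ← dist_eq_norm]
    exact (h hy2 (lt_trans hy1 hr.2)).le
  rw [dist_zero_right, setAverage_eq, norm_smul, norm_inv, Real.norm_of_nonneg (by positivity)]
  calc _ ≤ (volume.real (Metric.ball x r ∩ Ω))⁻¹ *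
        (ε / 2 * volume.real (Metric.ball x r ∩ Ω)) := by gcongr
    _ ≤ ε / 2 := by
      rw [mul_comm, mul_assoc]
      exact mul_le_of_le_one_right (half_pos hε).le mul_inv_le_one
    _ < ε := half_lt_self hε

lemma hasDiscreteTrace_of_mem {𝒯 : Triangulation Ω} {k : ℕ} (hb : Bornology.IsBounded Ω)
    {v : H1 Ω} (hv : v ∈ velocitySpace 𝒯 k) : HasDiscreteTrace 𝒯 k v := by
  obtain ⟨W, h1, h2, -⟩ := id hv
  exact ⟨v, hv, W, hasTrace_of_continuousOn hb h1 h2, hasTrace_of_continuousOn hb h1 h2⟩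

/-! ### The surface measure charges every relatively open subset of a Lipschitz boundary -/

lemma starProjection_add_smul {e : Vec d} (he : ‖e‖ = 1) (z : (ℝ ∙ e)ᗮ) (t : ℝ) :
    (ℝ ∙ e)ᗮ.starProjection ((z : Vec d) + t • e) = z ∧ ⟪e, (z : Vec d) + t • e⟫ = t := by
  constructor
  · rw [map_add, Submodule.starProjection_eq_self_iff.2 z.2, map_smul,
      Submodule.starProjection_apply_eq_zero_iff _ |>.2, smul_zero, add_zero]
    exact Submodule.le_orthogonal_orthogonal _ (Submodule.mem_span_singleton_self e)
  · rw [inner_add_right, inner_smul_right, real_inner_self_eq_norm_sq, he,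
      Submodule.mem_orthogonal_singleton_iff_inner_right.1 z.2]
    simp

lemma starProjection_add_inner_smul {e : Vec d} (he : ‖e‖ = 1) (x : Vec d) :
    (ℝ ∙ e)ᗮ.starProjection x + ⟪e, x⟫ • e = x := by
  rw [Submodule.starProjection_orthogonal_val, Submodule.starProjection_unit_singleton ℝ he]
  simp

/-- Near x the boundary contains the graph of γ over a nonempty open subset U of the hyperplane
orthogonal to e. Orthogonal projection does not increase Hausdorff measure and maps this graph onto
U, which has positive (d-1)-dimensional measure. -/
lemma surfaceMeasure_ball_ne_zero (hd : 1 ≤ d) (hΩ : IsLipschitzDomain Ω) {x : Vec d}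
    (hx : x ∈ frontier Ω) {r : ℝ} (hr : 0 < r) :
    surfaceMeasure Ω (Metric.ball x r) ≠ 0 := by
  obtain ⟨e, L, γ, r₀, he, hγ, hr₀, hgraph⟩ := hΩ.lipschitz x hx
  set K := (ℝ ∙ e)ᗮ
  have hxΩ : x ∉ Ω := fun h => hx.2 (hΩ.isOpen.interior_eq.symm ▸ h)
  -- A boundary point lies on the graph: x ∉ Ω gives one inequality, and x being a limit of points
  -- of Ω in the ball gives the other.
  have hγx : ⟪e, x⟫ = γ (K.starProjection x) := by
    refine le_antisymm (not_lt.1 fun h => hxΩ ((hgraph x (Metric.mem_ball_self hr₀)).2 h)) ?_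
    have hcl : x ∈ closure (Metric.ball x r₀ ∩ Ω) :=
      mem_closure_iff.2 fun o ho hxo => by
        obtain ⟨y, hy⟩ := mem_closure_iff.1 hx.1 (o ∩ Metric.ball x r₀)
          (ho.inter Metric.isOpen_ball) ⟨hxo, Metric.mem_ball_self hr₀⟩
        exact ⟨y, hy.1.1, hy.1.2, hy.2⟩
    have hclosed : IsClosed {y : Vec d | γ (K.starProjection y) ≤ ⟪e, y⟫} :=
      isClosed_le (hγ.continuous.comp K.starProjection.continuous) (by fun_prop)
    exact closure_minimal (fun y hy => ((hgraph y hy.1).1 hy.2).le) hclosed hcl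
  set F : K → Vec d := fun z => (z : Vec d) + γ z • e
  have hF : Continuous F := by
    have := hγ.continuous
    fun_prop
  have hFx : F (K.orthogonalProjectionOnto x) = x := by
    have := starProjection_add_inner_smul he x
    rw [hγx] at this
    exact this
  set U : Set K := F ⁻¹' Metric.ball x (min r r₀)
  have hU : IsOpen U := Metric.isOpen_ball.preimage hF
  have hUne : U.Nonempty :=
    ⟨K.orthogonalProjectionOnto x, by simp [U, hFx, hr, hr₀]⟩
  have hfront : ∀ z ∈ U, F z ∈ Metric.ball x r ∩ frontier Ω := by
    intro z hz
    have hzr : F z ∈ Metric.ball x r₀ := Metric.ball_subset_ball (min_le_right _ _) hz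
    refine ⟨Metric.ball_subset_ball (min_le_left _ _) hz, ?_⟩
    rw [hΩ.isOpen.frontier_eq]
    constructor
    -- Moving up from the graph in direction e enters Ω, while the graph point itself fails the
    -- strict inequality.
    · have hlim : Tendsto (fun t : ℝ => (z : Vec d) + t • e) (𝓝[>] (γ z)) (𝓝 (F z)) :=
        (Continuous.tendsto (by fun_prop) _).mono_left nhdsWithin_le_nhds
      refine mem_closure_of_tendsto hlim ?_
      filter_upwards [self_mem_nhdsWithin, hlim (Metric.isOpen_ball.mem_nhds hzr)] with t ht htr
      obtain ⟨h1, h2⟩ := starProjection_add_smul he z t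
      rw [hgraph _ htr, h1, h2]
      exact ht
    · obtain ⟨h1, h2⟩ := starProjection_add_smul he z (γ z)
      intro h
      have := (hgraph _ hzr).1 h
      rw [h1, h2] at this
      exact this.false
  have hsub : U ⊆ K.orthogonalProjectionOnto '' (Metric.ball x r ∩ frontier Ω) := by
    intro z hz
    refine ⟨F z, hfront z hz, Subtype.ext ?_⟩
    exact (starProjection_add_smul he z (γ z)).1
  have hfin : Module.finrank ℝ K = d - 1 := by
    have : Fact (Module.finrank ℝ (Vec d) = (d - 1) + 1) := ⟨by simp; omega⟩
    exact Submodule.finrank_orthogonal_span_singleton (by rintro rfl; simp at he)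
  have hpos : (Measure.euclideanHausdorffMeasure (d - 1) : Measure K) U ≠ 0 := by
    rw [← hfin]
    exact (hU.measure_pos _ hUne).ne'
  have hscal := Measure.addHaarScalarFactor_volume_hausdorffMeasure_ne_zero (d - 1)
  have hpos' : Measure.hausdorffMeasure ((d - 1 : ℕ) : ℝ) U ≠ 0 := by
    intro h0
    apply hpos
    rw [Measure.euclideanHausdorffMeasure_def, Measure.smul_apply, h0, smul_zero]
  have hle := (measure_mono hsub).trans
    (hausdorffMeasure_orthogonalProjectionOnto_le K ((d - 1 : ℕ) : ℝ)
      (Metric.ball x r ∩ frontier Ω) (by positivity))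
  rw [surfaceMeasure, Measure.restrict_apply measurableSet_ball,
    Measure.euclideanHausdorffMeasure_def, Measure.smul_apply]
  intro h0
  rcases smul_eq_zero.1 h0 with h | h
  · exact hscal h
  · exact hpos' (le_antisymm (h ▸ hle) zero_le)

lemma eqOn_frontier_zero (hd : 1 ≤ d) (hΩ : IsLipschitzDomain Ω) {W : Vec d → Vec d}
    (hW : ContinuousOn W (closure Ω)) (h0 : ∀ᵐ x ∂(surfaceMeasure Ω), W x = 0) :
    ∀ x ∈ frontier Ω, W x = 0 := by
  intro x hx
  by_contra hne
  have hev : ∀ᶠ y in 𝓝[closure Ω] x, W y ≠ 0 :=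
    (hW x (frontier_subset_closure hx)).eventually_ne hne
  obtain ⟨r, hr, hball⟩ := Metric.mem_nhdsWithin_iff.1 hev
  refine surfaceMeasure_ball_ne_zero hd hΩ hx hr ?_
  refine measure_mono_null (t := {y | ¬ W y = 0} ∪ {y | ¬ y ∈ frontier Ω}) (fun y hy => ?_)
    (measure_union_null h0 ae_surfaceMeasure_mem_frontier)
  by_cases hyf : y ∈ frontier Ω
  · exact Or.inl (hball ⟨hy, frontier_subset_closure hyf⟩)
  · exact Or.inr hyf

/-! ### Weak gradients of Lipschitz fields -/

/-- Both integrands vanish off Ω with φ, so this is integration by parts on the whole space for two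
Lipschitz functions, one of them compactly supported. -/
lemma integral_mul_partialDeriv_of_lipschitz {K : NNReal} {u : Vec d → ℝ} (hu : LipschitzWith K u)
    {φ : Vec d → ℝ} (hφ : ContDiff ℝ ∞ φ) (hc : HasCompactSupport φ) (hs : tsupport φ ⊆ Ω)
    (j : Fin d) :
    ∫ x in Ω, u x * partialDeriv φ j x =
      -∫ x in Ω, lineDeriv ℝ u x (EuclideanSpace.single j 1) * φ x := by
  obtain ⟨C, hC⟩ := (hφ.of_le (m := 1) (by simp)).lipschitzWith_of_hasCompactSupport hc (by simp)
  have h1 : ∀ x, x ∉ Ω → u x * partialDeriv φ j x = 0 := fun x hx => by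
    rw [partialDeriv, image_eq_zero_of_notMem_tsupport (f := fderiv ℝ φ)
      (fun h => hx (hs (tsupport_fderiv_subset ℝ h)))]
    simp
  have h2 : ∀ x, x ∉ Ω → lineDeriv ℝ u x (EuclideanSpace.single j 1) * φ x = 0 := fun x hx => by
    rw [image_eq_zero_of_notMem_tsupport (fun h => hx (hs h)), mul_zero]
  rw [setIntegral_eq_integral_of_forall_compl_eq_zero h1,
    setIntegral_eq_integral_of_forall_compl_eq_zero h2,
    hu.integral_lineDeriv_mul_eq hC hc, ← integral_neg]
  congr 1 with x
  rw [lineDeriv_neg, (hφ.differentiable (by simp) x).lineDeriv_eq_fderiv, partialDeriv]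
  ring

/-- The matrix field of the line derivatives of the components of a vector field. -/
def jacobian (U : Vec d → Vec d) (x : Vec d) : Mat d :=
  WithLp.toLp 2 fun ij => lineDeriv ℝ (fun y => U y ij.1) x (EuclideanSpace.single ij.2 1)

lemma lipschitzWith_coord {K : NNReal} {U : Vec d → Vec d} (hU : LipschitzWith K U) (i : Fin d) :
    LipschitzWith K (fun y => U y i) :=
  LipschitzWith.of_dist_le_mul fun x y => by
    refine le_trans ?_ (hU.dist_le_mul x y)
    rw [dist_eq_norm, dist_eq_norm, ← PiLp.sub_apply]
    exact PiLp.norm_apply_le _ i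

lemma norm_jacobian_apply_le {K : NNReal} {U : Vec d → Vec d} (hU : LipschitzWith K U)
    (x : Vec d) (ij : Fin d × Fin d) : ‖jacobian U x ij‖ ≤ K := by
  have := norm_lineDeriv_le_of_lipschitz ℝ (lipschitzWith_coord hU ij.1) (x₀ := x)
    (v := EuclideanSpace.single ij.2 1)
  simpa [jacobian] using this

lemma norm_jacobian_le {K : NNReal} {U : Vec d → Vec d} (hU : LipschitzWith K U) (x : Vec d) :
    ‖jacobian U x‖ ≤ d * K := by
  rw [EuclideanSpace.norm_eq]
  refine Real.sqrt_le_iff.2 ⟨by positivity, ?_⟩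
  calc ∑ ij, ‖jacobian U x ij‖ ^ 2 ≤ ∑ _ij : Fin d × Fin d, (K : ℝ) ^ 2 := by
        gcongr; exact norm_jacobian_apply_le hU x _
    _ = (d * K) ^ 2 := by simp; ring

lemma aestronglyMeasurable_jacobian {K : NNReal} {U : Vec d → Vec d} (hU : LipschitzWith K U)
    (μ : Measure (Vec d)) : AEStronglyMeasurable (jacobian U) μ := by
  refine Measurable.aestronglyMeasurable ?_
  refine (WithLp.measurable_toLp 2 _).comp (measurable_pi_lambda _ fun ij => ?_)
  exact measurable_lineDeriv (lipschitzWith_coord hU ij.1).continuous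

lemma memLp_of_continuous (hb : Bornology.IsBounded Ω) {U : Vec d → Vec d} (hU : Continuous U) :
    MemLp U 2 (volume.restrict Ω) := by
  have hcpt : IsCompact (closure Ω) := hb.isCompact_closure
  have := isFiniteMeasure_restrict hb.closure
  obtain ⟨C, hC⟩ := hcpt.exists_bound_of_continuousOn hU.continuousOn
  have : MemLp U 2 (volume.restrict (closure Ω)) :=
    MemLp.of_bound hU.aestronglyMeasurable C
      ((ae_restrict_mem isClosed_closure.measurableSet).mono hC)
  exact this.mono_measure (Measure.restrict_mono subset_closure le_rfl)

/-- A Lipschitz field on a bounded set belongs to `H¹`, and its weak gradient is given by its line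
derivatives. -/
lemma exists_H1_of_lipschitz (hb : Bornology.IsBounded Ω) {K : NNReal} {U : Vec d → Vec d}
    (hU : LipschitzWith K U) :
    ∃ w : H1 Ω, toField w =ᵐ[volume.restrict Ω] U ∧ grad w =ᵐ[volume.restrict Ω] jacobian U := by
  have := isFiniteMeasure_restrict hb
  have hJ : MemLp (jacobian U) 2 (volume.restrict Ω) :=
    MemLp.of_bound (aestronglyMeasurable_jacobian hU _) (d * K)
      (Eventually.of_forall (norm_jacobian_le hU))
  have hU2 := memLp_of_continuous hb hU.continuous
  refine ⟨⟨WithLp.toLp 2 (hU2.toLp U, hJ.toLp (jacobian U)), fun φ hφ hc hs i j => ?_⟩,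
    hU2.coeFn_toLp, hJ.coeFn_toLp⟩
  change ∫ x in Ω, (hU2.toLp U) x i * partialDeriv φ j x =
    -∫ x in Ω, (hJ.toLp (jacobian U)) x (i, j) * φ x
  rw [show ∫ x in Ω, (hU2.toLp U) x i * partialDeriv φ j x =
      ∫ x in Ω, U x i * partialDeriv φ j x from integral_congr_ae (by
        filter_upwards [hU2.coeFn_toLp] with x hx; rw [hx]),
    show ∫ x in Ω, (hJ.toLp (jacobian U)) x (i, j) * φ x =
      ∫ x in Ω, lineDeriv ℝ (fun y => U y i) x (EuclideanSpace.single j 1) * φ x from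
      integral_congr_ae (by filter_upwards [hJ.coeFn_toLp] with x hx; rw [hx]; rfl)]
  exact integral_mul_partialDeriv_of_lipschitz (lipschitzWith_coord hU i) hφ hc hs j

/-- The weak gradient is determined by the field. -/
lemma toField_injective (ho : IsOpen Ω) (hb : Bornology.IsBounded Ω) :
    Function.Injective (toField : H1 Ω → L2Vec Ω) := by
  have := isFiniteMeasure_restrict hb
  suffices h : ∀ v : H1 Ω, toField v = 0 → grad v = 0 by
    intro v w hvw
    have h0 : toField (v - w) = 0 := sub_eq_zero.2 hvw
    have h1 : grad v = grad w := by
      have := h _ h0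
      rwa [map_sub, sub_eq_zero] at this
    exact Subtype.ext (WithLp.ofLp_injective 2 (Prod.ext hvw h1))
  intro v hv
  have hzero : toField v =ᵐ[volume.restrict Ω] 0 := hv ▸ Lp.coeFn_zero _ _ _
  have key : ∀ ij : Fin d × Fin d, ∀ᵐ x ∂volume.restrict Ω, grad v x ij = 0 := by
    intro ij
    rw [ae_restrict_iff' ho.measurableSet]
    have hint : Integrable (fun x => grad v x ij) (volume.restrict Ω) :=
      ((EuclideanSpace.proj (𝕜 := ℝ) ij).comp_memLp' (Lp.memLp (grad v))).integrable (by norm_num)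
    refine ho.ae_eq_zero_of_integral_contDiff_smul_eq_zero
      (IntegrableOn.locallyIntegrableOn hint) fun φ hφ hc hs => ?_
    have h1 := v.2 φ hφ hc hs ij.1 ij.2
    have h2 : ∫ x in Ω, toField v x ij.1 * partialDeriv φ ij.2 x = 0 := by
      refine integral_eq_zero_of_ae ?_
      filter_upwards [hzero] with x hx
      simp [hx]
    rw [← setIntegral_eq_integral_of_forall_compl_eq_zero (s := Ω)]
    · calc _ = ∫ x in Ω, grad v x (ij.1, ij.2) * φ x := by
            congr 1 with x; rw [smul_eq_mul, mul_comm]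
        _ = 0 := by
            rw [← neg_eq_zero]
            exact h1.symm.trans h2
    · intro x hx
      rw [image_eq_zero_of_notMem_tsupport (fun h => hx (hs h)), zero_smul]
  refine Lp.ext ?_
  filter_upwards [ae_all_iff.2 key, Lp.coeFn_zero (Mat d) 2 (volume.restrict Ω)] with x hx h0
  rw [h0]
  ext ij
  exact hx ij

/-- By `toField_injective`, v is the element of `H1 Ω` built from U, whose gradient is known. -/
lemma grad_ae_eq_jacobian (ho : IsOpen Ω) (hb : Bornology.IsBounded Ω) {K : NNReal}
    {U : Vec d → Vec d} (hU : LipschitzWith K U) {v : H1 Ω}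
    (hv : toField v =ᵐ[volume.restrict Ω] U) : grad v =ᵐ[volume.restrict Ω] jacobian U := by
  obtain ⟨w, h1, h2⟩ := exists_H1_of_lipschitz hb hU
  rwa [toField_injective ho hb (Lp.ext (hv.trans h1.symm))]

/-- Bounded almost everywhere convergence implies convergence in `L²`. -/
lemma tendsto_L2_of_bounded {E : Type*} [NormedAddCommGroup E] {μ : Measure (Vec d)}
    [IsFiniteMeasure μ] {f : ℕ → Lp E 2 μ} {g : Lp E 2 μ} (C : ℝ)
    (hbd : ∀ n, ∀ᵐ x ∂μ, ‖f n x - g x‖ ≤ C)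
    (hlim : ∀ᵐ x ∂μ, Tendsto (fun n => f n x) atTop (𝓝 (g x))) :
    Tendsto f atTop (𝓝 g) := by
  rw [Lp.tendsto_Lp_iff_tendsto_eLpNorm']
  have hzero : ∫⁻ _ : Vec d, (0 : ENNReal) ∂μ = 0 := by simp
  have key : Tendsto (fun n => ∫⁻ x, ‖f n x - g x‖ₑ ^ (2 : ℝ) ∂μ) atTop (𝓝 0) := by
    rw [← hzero]
    refine tendsto_lintegral_of_dominated_convergence' (fun _ => ENNReal.ofReal C ^ (2 : ℝ))
      (fun n => ?_) (fun n => ?_) ?_ ?_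
    · exact ((Lp.aestronglyMeasurable (f n)).sub
        (Lp.aestronglyMeasurable g)).enorm.pow_const _
    · filter_upwards [hbd n] with x hx
      rw [← ofReal_norm]
      gcongr
    · rw [lintegral_const]
      exact ENNReal.mul_ne_top (by simp) (measure_ne_top μ _)
    · filter_upwards [hlim] with x hx
      have : Tendsto (fun n => ‖f n x - g x‖ₑ) atTop (𝓝 0) := by
        simpa using (hx.sub_const (g x)).enorm
      simpa using this.ennrpow_const (2 : ℝ)
  have h2 := key.ennrpow_const (1 / 2 : ℝ)
  rw [ENNReal.zero_rpow_of_pos (by norm_num)] at h2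
  refine h2.congr fun n => ?_
  rw [eLpNorm_eq_lintegral_rpow_enorm_toReal (by norm_num) (by norm_num)]
  simp

/-! ### Mollification -/

/-- The convolution of a function with a normalised bump function. -/
def mollify {E : Type*} [NormedAddCommGroup E] [NormedSpace ℝ E] (φ : ContDiffBump (0 : Vec d))
    (u : Vec d → E) (x : Vec d) : E :=
  ∫ t, φ.normed volume t • u (x - t)

section
variable {E : Type*} [NormedAddCommGroup E] [NormedSpace ℝ E] (φ : ContDiffBump (0 : Vec d))

lemma integrable_normed_smul {u : Vec d → E} (hu : Continuous u) (x : Vec d) :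
    Integrable (fun t => φ.normed volume t • u (x - t)) volume :=
  (φ.continuous_normed.smul (by fun_prop)).integrable_of_hasCompactSupport
    (φ.hasCompactSupport_normed.smul_right)

lemma normed_eq_zero {t : Vec d} (ht : φ.rOut ≤ ‖t‖) : φ.normed volume t = 0 := by
  rw [← Function.notMem_support, φ.support_normed_eq]
  simpa using ht

lemma mollify_congr {u v : Vec d → E} {x : Vec d} (h : EqOn u v (Metric.ball x φ.rOut)) :
    mollify φ u x = mollify φ v x := by
  refine integral_congr_ae (Eventually.of_forall fun t => ?_)
  rcases lt_or_ge ‖t‖ φ.rOut with ht | ht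
  · simp only
    rw [h (by simpa [Metric.mem_ball, dist_eq_norm] using ht)]
  · simp [normed_eq_zero φ ht]

lemma lipschitzWith_mollify {K : NNReal} {u : Vec d → E} (hu : LipschitzWith K u) :
    LipschitzWith K (mollify φ u) := by
  refine LipschitzWith.of_dist_le_mul fun x y => ?_
  rw [dist_eq_norm, mollify, mollify, ← integral_sub (integrable_normed_smul φ hu.continuous x)
    (integrable_normed_smul φ hu.continuous y)]
  calc _ ≤ ∫ t, φ.normed volume t * (K * dist x y) := by
        refine norm_integral_le_of_norm_le (φ.integrable_normed.mul_const _)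
          (Eventually.of_forall fun t => ?_)
        rw [← smul_sub, norm_smul, Real.norm_of_nonneg (φ.nonneg_normed t), ← dist_eq_norm]
        refine mul_le_mul_of_nonneg_left ?_ (φ.nonneg_normed t)
        simpa using hu.dist_le_mul (x - t) (y - t)
    _ = K * dist x y := by rw [integral_mul_const, φ.integral_normed, one_mul]

lemma dist_mollify_le {K : NNReal} {u : Vec d → E} [CompleteSpace E] (hu : LipschitzWith K u)
    (x : Vec d) : dist (mollify φ u x) (u x) ≤ K * φ.rOut :=
  φ.dist_normed_convolution_le hu.continuous.aestronglyMeasurable fun y hy =>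
    (hu.dist_le_mul y x).trans (by gcongr; exact (Metric.mem_ball.1 hy).le)

lemma contDiff_mollify [CompleteSpace E] {u : Vec d → E} (hu : Continuous u) :
    ContDiff ℝ ∞ (mollify φ u) :=
  φ.hasCompactSupport_normed.contDiff_convolution_left (n := ⊤) (μ := volume)
    (ContinuousLinearMap.lsmul ℝ ℝ) φ.contDiff_normed hu.locallyIntegrable

end

lemma mollify_apply (φ : ContDiffBump (0 : Vec d)) {U : Vec d → Vec d} (hU : Continuous U)
    (x : Vec d) (i : Fin d) : mollify φ U x i = mollify φ (fun y => U y i) x :=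
  ((EuclideanSpace.proj (𝕜 := ℝ) i).integral_comp_comm (integrable_normed_smul φ hU x)).symm

/-- Difference quotients commute with convolution. Those of the Lipschitz function u, integrated
against the bump, converge to the integral of its line derivative; those of the smooth mollification
converge to its own derivative. -/
lemma lineDeriv_mollify (φ : ContDiffBump (0 : Vec d)) {K : NNReal} {u : Vec d → ℝ}
    (hu : LipschitzWith K u) (x e : Vec d) :
    lineDeriv ℝ (mollify φ u) x e = mollify φ (fun y => lineDeriv ℝ u y e) x := by
  have hdiff := ((contDiff_mollify φ hu.continuous).differentiable (by simp) x)
  have hslope := hdiff.lineDifferentiableAt (v := e) |>.hasLineDerivAt.tendsto_slope_zero_right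
  have hf : LipschitzWith K (fun s => u (x - s)) :=
    LipschitzWith.of_dist_le_mul fun s t =>
      (hu.dist_le_mul (x - s) (x - t)).trans_eq (by rw [dist_sub_left])
  -- The variable s enters as x - s, so moving x along e means moving s along -e.
  have hlim := hf.integral_inv_smul_sub_mul_tendsto_integral_lineDeriv_mul
    (μ := volume) (φ.integrable_normed (μ := volume)) (-e)
  have heq : ∀ t : ℝ, ∫ s, (t⁻¹ • (u (x - (s + t • -e)) - u (x - s))) * φ.normed volume s =
      t⁻¹ • (mollify φ u (x + t • e) - mollify φ u x) := by
    intro t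
    rw [mollify, mollify, ← integral_sub (integrable_normed_smul φ hu.continuous _)
      (integrable_normed_smul φ hu.continuous x), ← integral_smul]
    congr 1 with s
    rw [show x - (s + t • -e) = x + t • e - s by rw [smul_neg]; abel]
    simp only [smul_eq_mul]
    ring
  rw [tendsto_nhds_unique hslope (hlim.congr heq), mollify]
  congr 1 with s
  rw [smul_eq_mul, mul_comm]
  congr 1
  simp only [lineDeriv]
  congr 1 with t
  rw [show x - (s + t • -e) = x - s + t • e by rw [smul_neg]; abel]

/-! ### Cut-off near the boundary -/

/-- A cut-off function: `0` where the distance to the complement of `Ω` is at most `ε`, and `1`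
where it is at least `2 ε`. -/
def cutoff (Ω : Set (Vec d)) (ε : ℝ) (x : Vec d) : ℝ :=
  max 0 (min 1 (Metric.infDist x Ωᶜ / ε - 1))

lemma cutoff_nonneg (ε : ℝ) (x : Vec d) : 0 ≤ cutoff Ω ε x := le_max_left _ _

lemma cutoff_le_one (ε : ℝ) (x : Vec d) : cutoff Ω ε x ≤ 1 :=
  max_le zero_le_one (min_le_left _ _)

lemma cutoff_eq_zero {ε : ℝ} (hε : 0 < ε) {x : Vec d} (h : Metric.infDist x Ωᶜ ≤ ε) :
    cutoff Ω ε x = 0 := by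
  refine max_eq_left ((min_le_right _ _).trans ?_)
  rw [sub_nonpos, div_le_one hε]
  exact h

lemma cutoff_eq_one {ε : ℝ} (hε : 0 < ε) {x : Vec d} (h : 2 * ε ≤ Metric.infDist x Ωᶜ) :
    cutoff Ω ε x = 1 := by
  have : 1 ≤ Metric.infDist x Ωᶜ / ε - 1 := by
    rw [le_sub_iff_add_le, le_div_iff₀ hε]
    linarith
  rw [cutoff, min_eq_left this, max_eq_right zero_le_one]

lemma abs_cutoff_sub_le {ε : ℝ} (hε : 0 < ε) (x y : Vec d) :
    |cutoff Ω ε x - cutoff Ω ε y| ≤ dist x y / ε := by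
  rw [cutoff, cutoff, max_comm 0, max_comm 0]
  refine (abs_max_sub_max_le_abs _ _ _).trans ?_
  rw [min_comm 1, min_comm 1]
  refine (abs_inf_sub_inf_le_abs _ _ _).trans ?_
  rw [sub_sub_sub_cancel_right, ← sub_div, abs_div, abs_of_pos hε]
  gcongr
  have := (Metric.lipschitz_infDist_pt (Ωᶜ)).dist_le_mul x y
  rwa [NNReal.coe_one, one_mul, Real.dist_eq] at this

lemma norm_le_infDist {K : NNReal} {V : Vec d → Vec d} (ho : IsOpen Ω) (hne : (Ωᶜ).Nonempty)
    (hV : LipschitzWith K V) (h0 : ∀ x ∉ Ω, V x = 0) (x : Vec d) :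
    ‖V x‖ ≤ K * Metric.infDist x Ωᶜ := by
  obtain ⟨y, hy, hxy⟩ := ho.isClosed_compl.exists_infDist_eq_dist hne x
  rw [hxy]
  simpa [h0 y hy] using hV.dist_le_mul x y

/-- The cut-off has slope 1/ε, but where it varies ‖V‖ ≤ 2εK, because V vanishes off Ω. The product
rule then gives K + 2K, uniformly in ε; this uniformity is what allows dominated convergence later.
-/
lemma lipschitzWith_cutoff_smul {K : NNReal} {V : Vec d → Vec d} (ho : IsOpen Ω)
    (hne : (Ωᶜ).Nonempty) (hV : LipschitzWith K V) (h0 : ∀ x ∉ Ω, V x = 0) {ε : ℝ} (hε : 0 < ε) :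
    LipschitzWith (3 * K) (fun x => cutoff Ω ε x • V x) := by
  -- The splitting evaluates V at y only, so it suffices that one of the two points is near the
  -- complement; if neither is, both cut-offs equal 1.
  have key : ∀ x y, Metric.infDist y Ωᶜ ≤ 2 * ε →
      dist (cutoff Ω ε x • V x) (cutoff Ω ε y • V y) ≤ 3 * K * dist x y := by
    intro x y hy
    rw [dist_eq_norm, show cutoff Ω ε x • V x - cutoff Ω ε y • V y =
      cutoff Ω ε x • (V x - V y) + (cutoff Ω ε x - cutoff Ω ε y) • V y by
        rw [smul_sub, sub_smul]; abel]
    refine (norm_add_le _ _).trans ?_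
    rw [norm_smul, norm_smul, Real.norm_of_nonneg (cutoff_nonneg _ _), ← dist_eq_norm,
      Real.norm_eq_abs]
    have h1 : cutoff Ω ε x * dist (V x) (V y) ≤ 1 * (K * dist x y) := by
      gcongr
      exacts [cutoff_le_one _ _, hV.dist_le_mul x y]
    have h2 : |cutoff Ω ε x - cutoff Ω ε y| * ‖V y‖ ≤ dist x y / ε * (K * (2 * ε)) := by
      gcongr
      · exact abs_cutoff_sub_le hε x y
      · exact (norm_le_infDist ho hne hV h0 y).trans (by gcongr)
    have h3 : dist x y / ε * (K * (2 * ε)) = 2 * K * dist x y := by field_simp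
    linarith
  refine LipschitzWith.of_dist_le_mul fun x y => ?_
  push_cast
  rcases le_total (Metric.infDist y Ωᶜ) (2 * ε) with hy | hy
  · exact key x y hy
  rcases le_total (Metric.infDist x Ωᶜ) (2 * ε) with hx | hx
  · rw [dist_comm, dist_comm x]
    exact key y x hx
  · simp only [cutoff_eq_one hε hx, cutoff_eq_one hε hy, one_smul]
    refine (hV.dist_le_mul x y).trans ?_
    have : 0 ≤ K * dist x y := by positivity
    linarith

/-! ### Lipschitz fields vanishing outside `Ω` belong to `H¹₀` -/

/-- A bump function supported in the ball of radius `ε / 2`. -/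
def bumpOfRadius (ε : ℝ) (hε : 0 < ε) : ContDiffBump (0 : Vec d) where
  rIn := ε / 4
  rOut := ε / 2
  rIn_pos := by positivity
  rIn_lt_rOut := by linarith

/-- The cut-off and mollified field. -/
def smoothCutoff (Ω : Set (Vec d)) (V : Vec d → Vec d) (ε : ℝ) (hε : 0 < ε) : Vec d → Vec d :=
  mollify (bumpOfRadius ε hε) (fun x => cutoff Ω ε x • V x)

/-- The cut-off vanishes up to distance ε from the complement, and mollification spreads the support
by only ε/2. -/
lemma tsupport_smoothCutoff_subset (V : Vec d → Vec d) {ε : ℝ} (hε : 0 < ε) :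
    tsupport (smoothCutoff Ω V ε hε) ⊆ {x | ε / 2 ≤ Metric.infDist x Ωᶜ} := by
  refine closure_minimal (fun x hx => ?_)
    (isClosed_le continuous_const (Metric.continuous_infDist_pt _))
  by_contra hlt
  refine hx ?_
  have hlt' : Metric.infDist x Ωᶜ < ε / 2 := not_le.1 hlt
  rw [smoothCutoff, mollify_congr (v := fun _ => 0)]
  · simp [mollify]
  · intro y hy
    have hy' : dist y x < ε / 2 := hy
    have : Metric.infDist y Ωᶜ ≤ Metric.infDist x Ωᶜ + dist y x :=
      Metric.infDist_le_infDist_add_dist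
    simp only
    rw [cutoff_eq_zero hε (by linarith), zero_smul]

lemma tsupport_smoothCutoff_subset_self (V : Vec d → Vec d) {ε : ℝ} (hε : 0 < ε) :
    tsupport (smoothCutoff Ω V ε hε) ⊆ Ω := by
  intro x hx
  have h : ε / 2 ≤ Metric.infDist x Ωᶜ := tsupport_smoothCutoff_subset V hε hx
  by_contra hxΩ
  rw [Metric.infDist_zero_of_mem hxΩ] at h
  linarith

lemma lipschitzWith_smoothCutoff {K : NNReal} {V : Vec d → Vec d} (ho : IsOpen Ω)
    (hne : (Ωᶜ).Nonempty) (hV : LipschitzWith K V) (h0 : ∀ x ∉ Ω, V x = 0) {ε : ℝ} (hε : 0 < ε) :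
    LipschitzWith (3 * K) (smoothCutoff Ω V ε hε) :=
  lipschitzWith_mollify _ (lipschitzWith_cutoff_smul ho hne hV h0 hε)

lemma exists_testField_smoothCutoff {K : NNReal} {V : Vec d → Vec d} (ho : IsOpen Ω)
    (hne : (Ωᶜ).Nonempty) (hV : LipschitzWith K V) (h0 : ∀ x ∉ Ω, V x = 0) {ε : ℝ} (hε : 0 < ε)
    (hb : Bornology.IsBounded Ω) :
    ∃ w ∈ testFields Ω, toField w =ᵐ[volume.restrict Ω] smoothCutoff Ω V ε hε ∧
      grad w =ᵐ[volume.restrict Ω] jacobian (smoothCutoff Ω V ε hε) := by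
  obtain ⟨w, h1, h2⟩ := exists_H1_of_lipschitz hb
    (lipschitzWith_smoothCutoff ho hne hV h0 hε)
  refine ⟨w, ⟨_, contDiff_mollify _ (lipschitzWith_cutoff_smul ho hne hV h0 hε).continuous, ?_,
    tsupport_smoothCutoff_subset_self V hε, h1⟩, h1, h2⟩
  exact HasCompactSupport.of_support_subset_isCompact hb.isCompact_closure
    ((subset_tsupport _).trans ((tsupport_smoothCutoff_subset_self V hε).trans subset_closure))

/-- Distance 3ε at the centre leaves 2ε throughout the ball of radius ε, so the cut-off is invisible
there. -/
lemma cutoff_smul_eqOn (V : Vec d → Vec d) {ε : ℝ} (hε : 0 < ε) {x : Vec d} (hx : 3 * ε < Metric.infDist x Ωᶜ) :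
    EqOn (fun y => cutoff Ω ε y • V y) V (Metric.ball x ε) := by
  intro y hy
  have hy' : dist x y < ε := by rw [dist_comm]; exact hy
  have : Metric.infDist x Ωᶜ ≤ Metric.infDist y Ωᶜ + dist x y :=
    Metric.infDist_le_infDist_add_dist
  simp only
  rw [cutoff_eq_one hε (by linarith), one_smul]

lemma compl_nonempty (hd : 1 ≤ d) (hb : Bornology.IsBounded Ω) : (Ωᶜ).Nonempty := by
  have : Nonempty (Fin d) := ⟨⟨0, hd⟩⟩
  rw [nonempty_compl]
  rintro rfl
  exact NormedSpace.unbounded_univ ℝ (Vec d) hb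

lemma tendsto_smoothCutoff {K : NNReal} {V : Vec d → Vec d} (ho : IsOpen Ω)
    (hne : (Ωᶜ).Nonempty) (hV : LipschitzWith K V) (h0 : ∀ x ∉ Ω, V x = 0) {ε : ℕ → ℝ}
    (hε : ∀ n, 0 < ε n) (hlim : Tendsto ε atTop (𝓝 0)) {x : Vec d} (hx : x ∈ Ω) :
    Tendsto (fun n => smoothCutoff Ω V (ε n) (hε n) x) atTop (𝓝 (V x)) := by
  have hδ : 0 < Metric.infDist x Ωᶜ :=
    (ho.isClosed_compl.notMem_iff_infDist_pos hne).1 (by simpa using hx)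
  rw [tendsto_iff_dist_tendsto_zero]
  have hlim' : Tendsto (fun n => ((3 * K : NNReal) : ℝ) * (ε n / 2)) atTop (𝓝 0) := by
    simpa using (hlim.div_const 2).const_mul ((3 * K : NNReal) : ℝ)
  refine squeeze_zero' (Eventually.of_forall fun _ => dist_nonneg) ?_ hlim'
  filter_upwards [hlim.eventually_lt_const (show (0 : ℝ) < Metric.infDist x Ωᶜ / 3 by positivity)]
    with n hn
  have h1 := dist_mollify_le (bumpOfRadius (ε n) (hε n))
    (lipschitzWith_cutoff_smul ho hne hV h0 (hε n)) x
  have h2 : cutoff Ω (ε n) x • V x = V x :=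
    cutoff_smul_eqOn V (hε n) (by linarith) (Metric.mem_ball_self (hε n))
  rw [h2] at h1
  exact h1

/-- At a fixed interior point and for small ε the cut-off plays no role, so the Jacobian is the
mollification of the line derivatives of V, which converges almost everywhere by Lebesgue
differentiation. -/
lemma ae_tendsto_jacobian_smoothCutoff {K : NNReal} {V : Vec d → Vec d} (ho : IsOpen Ω)
    (hne : (Ωᶜ).Nonempty) (hV : LipschitzWith K V) (h0 : ∀ x ∉ Ω, V x = 0) {ε : ℕ → ℝ}
    (hε : ∀ n, 0 < ε n) (hlim : Tendsto ε atTop (𝓝 0)) :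
    ∀ᵐ x, x ∈ Ω →
      Tendsto (fun n => jacobian (smoothCutoff Ω V (ε n) (hε n)) x) atTop (𝓝 (jacobian V x)) := by
  have hrad : Tendsto (fun n => (bumpOfRadius (d := d) (ε n) (hε n)).rOut) atTop (𝓝 0) := by
    simpa [bumpOfRadius] using hlim.div_const 2
  have hconv : ∀ᵐ x : Vec d, ∀ ij : Fin d × Fin d,
      Tendsto (fun n => mollify (bumpOfRadius (ε n) (hε n))
        (fun y => lineDeriv ℝ (fun y => V y ij.1) y (EuclideanSpace.single ij.2 1)) x)
        atTop (𝓝 (lineDeriv ℝ (fun y => V y ij.1) x (EuclideanSpace.single ij.2 1))) :=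
    ae_all_iff.2 fun ij => ContDiffBump.ae_convolution_tendsto_right_of_locallyIntegrable
      -- The ratio of outer to inner radius is (ε/2)/(ε/4) = 2.
      hrad (K := 2) (Eventually.of_forall fun n => by simp only [bumpOfRadius]; linarith)
      ((lipschitzWith_coord hV ij.1).locallyIntegrable_lineDeriv _)
  filter_upwards [hconv] with x hx hxΩ
  have hδ : 0 < Metric.infDist x Ωᶜ :=
    (ho.isClosed_compl.notMem_iff_infDist_pos hne).1 (by simpa using hxΩ)
  suffices h : Tendsto (fun n => WithLp.ofLp (jacobian (smoothCutoff Ω V (ε n) (hε n)) x)) atTop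
      (𝓝 (WithLp.ofLp (jacobian V x))) from
    ((PiLp.continuous_toLp 2 _).tendsto _).comp h
  refine tendsto_pi_nhds.2 fun ij => (hx ij).congr' ?_
  filter_upwards [hlim.eventually_lt_const (show (0 : ℝ) < Metric.infDist x Ωᶜ / 3 by positivity)]
    with n hn
  have hL := lipschitzWith_cutoff_smul ho hne hV h0 (hε n)
  have heq := cutoff_smul_eqOn V (hε n) (x := x) (by linarith)
  change _ = lineDeriv ℝ (fun y => mollify (bumpOfRadius (ε n) (hε n))
    (fun x => cutoff Ω (ε n) x • V x) y ij.1) x (EuclideanSpace.single ij.2 1)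
  simp only [mollify_apply _ hL.continuous]
  have h1 := lineDeriv_mollify (bumpOfRadius (ε n) (hε n)) (lipschitzWith_coord hL ij.1) x
    (EuclideanSpace.single ij.2 1)
  refine Eq.trans ?_ h1.symm
  refine mollify_congr _ fun y hy => ?_
  have hy' : y ∈ Metric.ball x (ε n) :=
    Metric.ball_subset_ball (by simp only [bumpOfRadius]; linarith [hε n]) hy
  refine (Filter.EventuallyEq.lineDeriv_eq ?_).symm
  filter_upwards [Metric.isOpen_ball.mem_nhds hy'] with z hz
  have := heq hz
  simp only at this
  rw [this]

/-- A Lipschitz field that vanishes outside `Ω` belongs to `H¹₀(Ω)`. -/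
theorem mem_H10_of_lipschitz (ho : IsOpen Ω) (hb : Bornology.IsBounded Ω)
    (hne : (Ωᶜ).Nonempty) {K : NNReal} {V : Vec d → Vec d} (hV : LipschitzWith K V)
    (h0 : ∀ x ∉ Ω, V x = 0) {v : H1 Ω} (hv : toField v =ᵐ[volume.restrict Ω] V) : v ∈ H10 Ω := by
  have := isFiniteMeasure_restrict hb
  set ε : ℕ → ℝ := fun n => 1 / ((n : ℝ) + 1)
  have hε : ∀ n, 0 < ε n := fun n => by positivity
  have hlim : Tendsto ε atTop (𝓝 0) := tendsto_one_div_add_atTop_nhds_zero_nat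
  choose w hw hw1 hw2 using fun n => exists_testField_smoothCutoff ho hne hV h0 (hε n) hb
  have hgv := grad_ae_eq_jacobian ho hb hV hv
  have hfield : Tendsto (fun n => toField (w n)) atTop (𝓝 (toField v)) := by
    obtain ⟨R, hR⟩ := hb.isCompact_closure.exists_bound_of_continuousOn hV.continuous.continuousOn
    -- Mollifying moves the values by at most 3K times the radius, which is at most 1/2; the cut-off
    -- moves them by at most 2R.
    refine tendsto_L2_of_bounded ((3 * K : NNReal) * (1 / 2) + 2 * R) (fun n => ?_) ?_
    · filter_upwards [hw1 n, hv, ae_restrict_mem ho.measurableSet] with x h1 h2 hx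
      have hR' := hR x (subset_closure hx)
      have h3 := dist_mollify_le (bumpOfRadius (ε n) (hε n))
        (lipschitzWith_cutoff_smul ho hne hV h0 (hε n)) x
      have h4 : (bumpOfRadius (d := d) (ε n) (hε n)).rOut ≤ 1 / 2 := by
        have : ε n ≤ 1 := div_le_one_of_le₀ (by linarith [n.cast_nonneg (α := ℝ)]) (by positivity)
        simp only [bumpOfRadius]
        linarith
      have h5 : dist (cutoff Ω (ε n) x • V x) (V x) ≤ 2 * R := by
        rw [dist_eq_norm]
        refine (norm_sub_le _ _).trans ?_
        rw [norm_smul, Real.norm_of_nonneg (cutoff_nonneg _ _)]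
        nlinarith [cutoff_le_one (Ω := Ω) (ε n) x, norm_nonneg (V x)]
      rw [h1, h2, ← dist_eq_norm]
      refine (dist_triangle _ _ _).trans (add_le_add (h3.trans ?_) h5)
      gcongr
    · filter_upwards [ae_all_iff.2 hw1, hv, ae_restrict_mem ho.measurableSet] with x h1 h2 hx
      simp only [h1, h2]
      exact tendsto_smoothCutoff ho hne hV h0 hε hlim hx
  have hgrad : Tendsto (fun n => grad (w n)) atTop (𝓝 (grad v)) := by
    refine tendsto_L2_of_bounded (d * (3 * K : NNReal) + d * K) (fun n => ?_) ?_
    · filter_upwards [hw2 n, hgv] with x h1 h2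
      rw [h1, h2]
      exact (norm_sub_le _ _).trans (add_le_add
        (norm_jacobian_le (lipschitzWith_smoothCutoff ho hne hV h0 (hε n)) x)
        (norm_jacobian_le hV x))
    · filter_upwards [ae_all_iff.2 hw2, hgv,
        (ae_restrict_iff' ho.measurableSet).2
          (ae_tendsto_jacobian_smoothCutoff ho hne hV h0 hε hlim)] with x h1 h2 h3
      simp only [h1, h2]
      exact h3
  have hlimw : Tendsto w atTop (𝓝 v) := by
    rw [tendsto_subtype_rng]
    exact ((WithLp.prod_continuous_toLp 2 _ _).tendsto _).comp (hfield.prodMk_nhds hgrad)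
  exact mem_closure_of_tendsto hlimw (Eventually.of_forall hw)

/-! ### Piecewise Lipschitz fields -/

/-- A function on a normed space that is Lipschitz on each member of a finite closed cover is
Lipschitz. -/
lemma lipschitzWith_of_finite_closed_cover {E F ι : Type*} [NormedAddCommGroup E]
    [NormedSpace ℝ E] [NormedAddCommGroup F] [Finite ι] {A : ι → Set E}
    (hA : ∀ i, IsClosed (A i)) (hcov : ∀ x, ∃ i, x ∈ A i) {K : NNReal} {f : E → F}
    (hf : ∀ i, LipschitzOnWith K f (A i)) : LipschitzWith K f := by
  have hcont : Continuous f := (locallyFinite_of_finite A).continuous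
    (iUnion_eq_univ_iff.2 hcov) hA fun i => (hf i).continuousOn
  refine LipschitzWith.of_dist_le_mul fun y x => ?_
  set c : ℝ → E := fun t => x + t • (y - x)
  have hc : Continuous c := by fun_prop
  have hcdist : ∀ s t : ℝ, s ≤ t → dist (c t) (c s) = (t - s) * dist y x := by
    intro s t hst
    simp only [c, dist_eq_norm]
    rw [add_sub_add_left_eq_sub, ← sub_smul, norm_smul, Real.norm_of_nonneg (sub_nonneg.2 hst)]
  set M : ℝ := K * dist y x
  -- The comparison principle along the segment needs a barrier of slope strictly larger than M,
  -- hence the slack η.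
  refine le_of_forall_pos_le_add fun η hη => ?_
  have key := image_norm_le_of_liminf_right_slope_norm_lt_deriv_boundary
    (f := fun t => f (c t) - f x) (f' := fun _ => M) (a := 0) (b := 1)
    (B := fun t => (M + η) * t) (B' := fun _ => M + η)
    ((hcont.comp hc).sub continuous_const).continuousOn ?_ (by simp [c])
    (by fun_prop) (fun t _ => by simpa using (hasDerivWithinAt_id t _).const_mul (M + η))
    (fun _ _ _ => by linarith) (x := 1) (by simp)
  · simpa [c, dist_eq_norm] using key
  · intro t _ r hr
    -- By finiteness one piece contains c z for z arbitrarily close to t from the right; being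
    -- closed it contains c t. The Lipschitz bound on that piece controls the slope frequently,
    -- which is enough.
    have hfreq : ∃ᶠ z in 𝓝[>] t, ∃ i, c z ∈ A i := by
      refine Eventually.frequently (Eventually.of_forall fun z => hcov (c z))
    obtain ⟨i, hi⟩ := frequently_exists.1 hfreq
    have hti : c t ∈ A i := (hA i).mem_of_frequently_of_tendsto hi
      ((hc.tendsto t).mono_left nhdsWithin_le_nhds)
    refine (hi.and_eventually self_mem_nhdsWithin).mono fun z hz => ?_
    obtain ⟨hz, hzt⟩ := hz
    have hpos : 0 < z - t := sub_pos.2 hzt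
    refine lt_of_le_of_lt ?_ hr
    rw [slope_def_field, div_le_iff₀ hpos]
    refine (norm_sub_norm_le _ _).trans ?_
    rw [sub_sub_sub_cancel_right, ← dist_eq_norm]
    refine ((hf i).dist_le_mul _ hz _ hti).trans_eq ?_
    rw [hcdist t z (le_of_lt hzt)]
    ring

lemma exists_lipschitzOnWith_polynomial (P : Fin d → MvPolynomial (Fin d) ℝ) {S : Set (Vec d)}
    (hS : IsCompact S) (hconv : Convex ℝ S) {W : Vec d → Vec d}
    (hW : ∀ x ∈ S, ∀ i, W x i = (P i).eval (fun j => x j)) :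
    ∃ K, LipschitzOnWith K W S := by
  have hsmooth : ContDiff ℝ 1 (fun x : Vec d => WithLp.toLp 2
      fun i => (P i).eval (fun j => x j) : Vec d → Vec d) := by
    refine (PiLp.contDiff_toLp).comp (contDiff_pi.2 fun i => ?_)
    refine contDiff_iff_contDiffAt.2 fun x => ?_
    have h := AnalyticAt.aeval_mvPolynomial (𝕜 := ℝ) (f := fun (x : Vec d) j => x j) (z := x)
      (fun j => (EuclideanSpace.proj (𝕜 := ℝ) j).analyticAt x) (P i)
    exact h.contDiffAt
  obtain ⟨K, hK⟩ := hsmooth.contDiffOn.exists_lipschitzOnWith one_ne_zero hconv hS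
  refine ⟨K, fun x hx y hy => ?_⟩
  have hWx : ∀ z ∈ S, W z = WithLp.toLp 2 fun i => (P i).eval (fun j => z j) := fun z hz => by
    ext i
    exact hW z hz i
  rw [hWx x hx, hWx y hy]
  exact hK hx hy

/-- A discrete velocity with vanishing trace belongs to `H¹₀(Ω)`. -/
theorem mem_H10_of_hasTrace_zero (hd : 1 ≤ d) (hΩ : IsLipschitzDomain Ω) {𝒯 : Triangulation Ω}
    {k : ℕ} {v : H1 Ω} (hv : v ∈ velocitySpace 𝒯 k) (h0 : HasTrace Ω v 0) : v ∈ H10 Ω := by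
  have ho := hΩ.isOpen
  have hb := hΩ.isBounded
  obtain ⟨W, hW, hvW, hP⟩ := hv
  have hW0 : ∀ x ∈ frontier Ω, W x = 0 := by
    refine eqOn_frontier_zero hd hΩ hW ?_
    filter_upwards [(hasTrace_of_continuousOn hb hW hvW).unique ho hb h0] with x hx
    simpa using hx
  -- Since W vanishes on ∂Ω, the extension by zero equals W on the closure and so remains polynomial
  -- on each closed simplex.
  set V : Vec d → Vec d := Ω.indicator W
  have hV0 : ∀ x ∉ Ω, V x = 0 := fun x hx => indicator_of_notMem hx W
  have hVW : ∀ x ∈ closure Ω, V x = W x := by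
    intro x hx
    by_cases hxΩ : x ∈ Ω
    · exact indicator_of_mem hxΩ W
    · rw [hV0 x hxΩ, hW0 x ⟨hx, fun h => hxΩ (interior_subset h)⟩]
  have hcell : ∀ T ∈ 𝒯.cells, ∃ K, LipschitzOnWith K V (convexHull ℝ (T : Set (Vec d))) := by
    intro T hT
    choose P _ hP2 using hP T hT
    refine exists_lipschitzOnWith_polynomial P (T.finite_toSet.isCompact_convexHull ℝ)
      (convex_convexHull ℝ _) fun x hx i => ?_
    have hxcl : x ∈ closure Ω := by
      rw [← 𝒯.cover]
      exact mem_biUnion hT hx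
    rw [hVW x hxcl]
    exact hP2 i x hx
  choose! κ hκ using hcell
  set K : NNReal := 𝒯.cells.sup κ
  have hlip : LipschitzWith K V := by
    -- The simplices cover only the closure of Ω; `none` indexes the complement of Ω, where V = 0.
    refine lipschitzWith_of_finite_closed_cover (ι := Option 𝒯.cells)
      (A := fun o => o.elim Ωᶜ fun T => convexHull ℝ (T : Set (Vec d))) ?_ ?_ ?_
    · rintro (_ | T)
      · exact ho.isClosed_compl
      · exact (T.1.finite_toSet.isCompact_convexHull ℝ).isClosed
    · intro x
      by_cases hx : x ∈ Ω
      · have := subset_closure hx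
        rw [← 𝒯.cover] at this
        obtain ⟨T, hT, hxT⟩ := mem_iUnion₂.1 this
        exact ⟨some ⟨T, hT⟩, hxT⟩
      · exact ⟨none, hx⟩
    · rintro (_ | T)
      · intro x hx y hy
        rw [hV0 x hx, hV0 y hy]
        simp
      · exact (hκ T.1 T.2).weaken (Finset.le_sup T.2)
  refine mem_H10_of_lipschitz ho hb (compl_nonempty hd hb) hlip hV0 ?_
  filter_upwards [hvW, ae_restrict_mem ho.measurableSet] with x hx hxΩ
  rw [hx, hVW x (subset_closure hxΩ)]

/-! ### The divergence -/

lemma divg_ae (v : H1 Ω) :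
    divg v =ᵐ[volume.restrict Ω] fun x => ∑ i, grad v x (i, i) := by
  filter_upwards [(matTrace d).coeFn_compLpL (p := 2) (grad v)] with x hx
  refine hx.trans ?_
  simp [matTrace]

lemma continuous_grad : Continuous (grad : H1 Ω →ₗ[ℝ] L2Mat Ω) :=
  (WithLp.prod_continuous_ofLp 2 _ _).snd.comp continuous_subtype_val

lemma continuous_divg : Continuous (divg : H1 Ω →ₗ[ℝ] L2 Ω) :=
  ((matTrace d).compLpL 2 (volume.restrict Ω)).continuous.comp continuous_grad

/-- The value of C is immaterial: in `norm_pressure_sub_le` it multiplies a term that vanishes in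
the limit. -/
lemma exists_norm_divg_le : ∃ C : ℝ, 0 ≤ C ∧ ∀ v : H1 Ω, ‖divg v‖ ≤ C * ‖grad v‖ :=
  ⟨_, norm_nonneg _, fun v => ((matTrace d).compLpL 2 (volume.restrict Ω)).le_opNorm (grad v)⟩

lemma lineDeriv_const_eq_zero (c : ℝ) (x e : Vec d) : lineDeriv ℝ (fun _ => c) x e = 0 := by
  simp [lineDeriv]

lemma integral_divg_testField (ho : IsOpen Ω) (hb : Bornology.IsBounded Ω) {v : H1 Ω}
    (hv : v ∈ testFields Ω) : ∫ x in Ω, divg v x = 0 := by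
  obtain ⟨φ, h1, h2, h3, h4⟩ := hv
  obtain ⟨K, hK⟩ := (h1.of_le (m := 1) (by simp)).lipschitzWith_of_hasCompactSupport h2 (by simp)
  have hg := grad_ae_eq_jacobian ho hb hK h4
  have hfin := isFiniteMeasure_restrict hb
  have heq : (fun x => divg v x) =ᵐ[volume.restrict Ω] fun x => ∑ i, jacobian φ x (i, i) := by
    filter_upwards [divg_ae v, hg] with x hx hx'
    rw [hx, hx']
  have hint : ∀ i, Integrable (fun x => jacobian φ x (i, i)) (volume.restrict Ω) := fun i =>
    Integrable.of_bound ((EuclideanSpace.proj (𝕜 := ℝ) (i, i)).continuous.comp_aestronglyMeasurable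
      (aestronglyMeasurable_jacobian hK _)) K
      (Eventually.of_forall fun x => norm_jacobian_apply_le hK x (i, i))
  rw [integral_congr_ae heq, integral_finsetSum _ fun i _ => hint i]
  refine Finset.sum_eq_zero fun i _ => ?_
  have hsupp : ∀ x, x ∉ Ω → jacobian φ x (i, i) = 0 := by
    intro x hx
    have hx' : x ∉ tsupport φ := fun h => hx (h3 h)
    have hev : (fun y => φ y i) =ᶠ[𝓝 x] fun _ => 0 := by
      filter_upwards [(isClosed_tsupport φ).isOpen_compl.mem_nhds hx'] with y hy
      rw [image_eq_zero_of_notMem_tsupport hy]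
      rfl
    change lineDeriv ℝ (fun y => φ y i) x _ = 0
    rw [hev.lineDeriv_eq, lineDeriv_const_eq_zero]
  rw [setIntegral_eq_integral_of_forall_compl_eq_zero hsupp]
  have hcs : HasCompactSupport (fun y => φ y i) :=
    h2.comp_left (g := fun z : Vec d => z i) rfl
  have hibp := (LipschitzWith.const (1 : ℝ) (α := Vec d)).integral_lineDeriv_mul_eq (μ := volume)
    (lipschitzWith_coord hK i) hcs (EuclideanSpace.single i 1)
  simp only [mul_one, lineDeriv_neg, lineDeriv_const_eq_zero, zero_mul, integral_zero, integral_neg] at hibp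
  have : ∫ x, jacobian φ x (i, i) = ∫ x, lineDeriv ℝ (fun y => φ y i) x
    (EuclideanSpace.single i 1) := rfl
  rw [this]
  linarith

/-- Zero mean is orthogonality to the constant 1, a closed condition that passes from test fields to
their closure. Through Q_h = div V_h it makes discrete pressures admissible in the mass equation for
u. -/
lemma divg_mem_L20 (ho : IsOpen Ω) (hb : Bornology.IsBounded Ω) {v : H1 Ω} (hv : v ∈ H10 Ω) :
    divg v ∈ L20 Ω := by
  have hfin := isFiniteMeasure_restrict hb
  have hL20 : L20 Ω = {q : L2 Ω | ⟪indicatorConstLp 2 MeasurableSet.univ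
      (measure_ne_top (volume.restrict Ω) univ) (1 : ℝ), q⟫ = 0} := by
    ext q
    rw [mem_ofPred_eq, L2.inner_indicatorConstLp_one, Measure.restrict_univ]
    rfl
  have hclosed : IsClosed (divg ⁻¹' L20 Ω : Set (H1 Ω)) := by
    rw [hL20]
    exact (isClosed_eq (by fun_prop) continuous_const).preimage continuous_divg
  exact closure_minimal (fun w hw => integral_divg_testField ho hb hw) hclosed hv

variable {𝒯 : Triangulation Ω} {k : ℕ}

/-! ### The discrete spaces -/

/-- `Q_h` as the subspace `div V_h`. -/
lemma pressureSpace_eq (hdiv : divg '' (velocitySpaceZero 𝒯 k : Set (H1 Ω)) =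
      divg '' velocitySpaceSim 𝒯 k) :
    pressureSpace 𝒯 k = ((velocitySpaceZero 𝒯 k).map divg : Submodule ℝ (L2 Ω)) := by
  rw [pressureSpace, ← hdiv, Submodule.map_coe]

/-- A discrete velocity whose divergence lies in `Q_h` and is orthogonal to `Q_h` is
divergence-free. -/
lemma divg_eq_zero_of_orthogonal {v : H1 Ω} (hv : divg v ∈ pressureSpace 𝒯 k)
    (h : ∀ q ∈ pressureSpace 𝒯 k, ⟪divg v, q⟫ = 0) : divg v = 0 :=
  inner_self_eq_zero.1 (h _ hv)

/-- The condition 0 ≤ M absorbs the default values: a quotient with ‖∇v‖ = 0 is 0, and so is the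
supremum of an empty family. -/
lemma norm_le_of_infSup {β : ℝ} (h : InfSup 𝒯 k β) {q : L2 Ω} (hq : q ∈ pressureSpace 𝒯 k)
    {M : ℝ} (hM : 0 ≤ M)
    (hle : ∀ v ∈ velocitySpaceZero 𝒯 k, ⟪divg v, q⟫ ≤ M * ‖grad v‖) : β * ‖q‖ ≤ M :=
  (h q hq).trans (Real.iSup_le (fun v => div_le_of_le_mul₀ (norm_nonneg _) hM (hle v v.2.1)) hM)

/-- In a Galerkin setting, `a` is at most as far from `b` as from any `c` with `a - b ⊥ b - c`. -/
lemma norm_sub_le_of_orthogonal {E : Type*} [NormedAddCommGroup E] [InnerProductSpace ℝ E]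
    {a b c : E} (h : ⟪a - b, b - c⟫ = 0) : ‖a - b‖ ≤ ‖a - c‖ := by
  have h1 := norm_add_sq_real (a - b) (b - c)
  rw [sub_add_sub_cancel, h] at h1
  nlinarith [norm_nonneg (a - b), norm_nonneg (a - c), sq_nonneg ‖b - c‖]

/-! ### Error estimates for velocity and pressure -/

section
variable {ν : ℝ} {f : H10 Ω →L[ℝ] ℝ} {g u : H1 Ω} {p : L2 Ω} {gh uh : H1 Ω} {ph : L2 Ω}

/-- The error equation. -/
lemma IsDiscreteSolution.error_eq (hup : IsWeakSolution Ω ν f g u p)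
    (hsol : IsDiscreteSolution 𝒯 k ν f gh uh ph) {v : H1 Ω} (hv : v ∈ velocitySpaceZero 𝒯 k) :
    ν * ⟪grad u - grad uh, grad v⟫ = ⟪p - ph, divg v⟫ := by
  have h1 := hup.momentum ⟨v, hv.2⟩
  have h2 := hsol.momentum ⟨v, hv.2⟩ hv
  rw [inner_sub_left, inner_sub_left]
  linarith

/-- The velocity error is bounded by the stability constant of the Fortin operator times any
discrete approximation error. -/
theorem norm_grad_sub_le (hd : 1 ≤ d) (hΩ : IsLipschitzDomain Ω) (hν : 0 < ν)
    (hup : IsWeakSolution Ω ν f g u p)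
    (hdiv : divg '' (velocitySpaceZero 𝒯 k : Set (H1 Ω)) = divg '' velocitySpaceSim 𝒯 k)
    {P : H1 Ω →ₗ[ℝ] velocitySpace 𝒯 k} {c : ℝ} (hP : IsFortin 𝒯 k P c)
    (hgP : SameTrace Ω gh (P g : H1 Ω)) (hsol : IsDiscreteSolution 𝒯 k ν f gh uh ph)
    (huh : divg uh = 0) (v : velocitySpace 𝒯 k) :
    ‖grad u - grad uh‖ ≤ (1 + c) * ‖grad u - grad (v : H1 Ω)‖ := by
  have ho := hΩ.isOpen
  have hb := hΩ.isBounded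
  let w : H1 Ω := (P u).1
  -- The comparison field v + Π(u - v): divergence-free, with the trace of u_h, and with u - z = (u
  -- - v) - Π(u - v).
  let z : H1 Ω := w + ((v : H1 Ω) - P v)
  have hXz : z ∈ velocitySpace 𝒯 k := add_mem (P u).2 (sub_mem v.2 (P v).2)
  have hug : HasTrace Ω (u - g) 0 := hup.boundary.hasTrace_sub hb
  -- The traces of u and g need not be discrete, so trace preservation is applied to u - g, which
  -- has the trace of the discrete field 0.
  have hPug : HasTrace Ω ((P (u - g) : H1 Ω) - (u - g)) 0 :=
    (hP.trace_preserving _ ⟨0, zero_mem _, 0, hug, hasTrace_zero⟩).hasTrace_sub hb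
  have hPv : HasTrace Ω ((P v : H1 Ω) - v) 0 :=
    (hP.trace_preserving _ (hasDiscreteTrace_of_mem hb v.2)).hasTrace_sub hb
  have htrace : HasTrace Ω (uh - z) 0 := by
    have h := (((hsol.boundary.hasTrace_sub hb).add hb (hgP.hasTrace_sub hb)).sub hb
      (hPug.add hb hug)).add hb hPv
    have heq : uh - z = uh - gh + (gh - P g) - ((P (u - g) : H1 Ω) - (u - g) + (u - g)) +
        ((P v : H1 Ω) - v) := by
      simp only [z, w, map_sub, Submodule.coe_sub]
      abel
    rw [heq]
    simpa using h
  have hQ20 : ∀ q ∈ pressureSpace 𝒯 k, q ∈ L20 Ω := by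
    rintro q hq
    rw [pressureSpace, ← hdiv] at hq
    obtain ⟨y, hy, rfl⟩ := hq
    exact divg_mem_L20 ho hb hy.2
  have hw : divg w = 0 := by
    refine divg_eq_zero_of_orthogonal (𝒯 := 𝒯) (k := k)
      ⟨w, ⟨(P u).2, hP.mean_preserving u hup.mem_sim⟩, rfl⟩ fun q hq => ?_
    rw [hP.div_preserving u q hq]
    exact hup.mass q (hQ20 q hq)
  have hvP : divg ((v : H1 Ω) - (P v : H1 Ω)) = 0 := by
    have hmem : (v : H1 Ω) - (P v : H1 Ω) ∈ velocitySpaceZero 𝒯 k := by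
      refine ⟨sub_mem v.2 (P v).2, ?_⟩
      rw [← neg_sub]
      exact neg_mem (mem_H10_of_hasTrace_zero hd hΩ (sub_mem (P v).2 v.2) hPv)
    refine divg_eq_zero_of_orthogonal (𝒯 := 𝒯) (k := k) ?_ fun q hq => ?_
    · rw [pressureSpace, ← hdiv]
      exact mem_image_of_mem _ hmem
    · rw [map_sub, inner_sub_left, hP.div_preserving v q hq, sub_self]
  have hV : uh - z ∈ velocitySpaceZero 𝒯 k :=
    ⟨sub_mem hsol.mem_velocity hXz,
      mem_H10_of_hasTrace_zero hd hΩ (sub_mem hsol.mem_velocity hXz) htrace⟩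
  -- The test field u_h - z is divergence-free, so the pressure term of the error equation vanishes.
  have horth : ⟪grad u - grad uh, grad uh - grad z⟫ = 0 := by
    have h := hsol.error_eq hup hV
    rw [map_sub divg, huh, map_add divg, hw, hvP, add_zero, sub_zero, inner_zero_right] at h
    rw [← map_sub]
    exact (mul_eq_zero.1 h).resolve_left hν.ne'
  set e : H1 Ω := u - (v : H1 Ω) with he
  have hez : grad u - grad z = grad e - grad (P e : H1 Ω) := by
    have : u - z = e - (P e : H1 Ω) := by
      simp only [z, w, he, map_sub, Submodule.coe_sub]
      abel
    rw [← map_sub, this, map_sub]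
  calc ‖grad u - grad uh‖ ≤ ‖grad u - grad z‖ := norm_sub_le_of_orthogonal horth
    _ ≤ ‖grad e‖ + ‖grad (P e : H1 Ω)‖ := hez ▸ norm_sub_le _ _
    _ ≤ ‖grad e‖ + c * ‖grad e‖ := by gcongr; exact hP.stable e
    _ = (1 + c) * ‖grad u - grad (v : H1 Ω)‖ := by rw [he, map_sub]; ring

/-- The pressure error is controlled by the velocity error and the best approximation of the
pressure. -/
theorem norm_pressure_sub_le (hν : 0 < ν) (hup : IsWeakSolution Ω ν f g u p) {β : ℝ} (hβ : 0 < β)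
    (hinfsup : InfSup 𝒯 k β)
    (hdiv : divg '' (velocitySpaceZero 𝒯 k : Set (H1 Ω)) = divg '' velocitySpaceSim 𝒯 k)
    (hsol : IsDiscreteSolution 𝒯 k ν f gh uh ph) (r : pressureSpace 𝒯 k) :
    β * ‖p - ph‖ ≤ ν * ‖grad u - grad uh‖ + β * ‖p - r‖ := by
  obtain ⟨C, hC, hdivC⟩ := exists_norm_divg_le (Ω := Ω)
  set Q : Submodule ℝ (L2 Ω) := (velocitySpaceZero 𝒯 k).map divg
  have hQ : pressureSpace 𝒯 k = Q := pressureSpace_eq hdiv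
  -- Passing to the closure provides the orthogonal projection without using that Q_h is
  -- finite-dimensional.
  set R := Q.topologicalClosure
  have : CompleteSpace R := Q.isClosed_topologicalClosure.completeSpace_coe
  set s : L2 Ω := R.starProjection p
  have hsR : s ∈ R := R.starProjection_apply_mem p
  have hbest : ‖p - s‖ ≤ ‖p - r‖ := by
    have hr : (r : L2 Ω) ∈ R := Q.le_topologicalClosure (hQ ▸ r.2 : (r : L2 Ω) ∈ (Q : Set (L2 Ω)))
    refine norm_sub_le_of_orthogonal ?_
    exact Submodule.starProjection_inner_eq_zero p _ (sub_mem hsR hr)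
  -- The inf-sup condition applies only to elements of Q_h, so s is replaced by q ∈ Q_h at the price
  -- C‖q - s‖; letting q tend to s removes it.
  have happrox : ∀ q ∈ Q, β * ‖ph - q‖ ≤ ν * ‖grad u - grad uh‖ + C * ‖q - s‖ := by
    intro q hq
    refine norm_le_of_infSup hinfsup (q := ph - q) ?_ (by positivity) fun v hv => ?_
    · rw [hQ]
      exact sub_mem (hQ ▸ hsol.mem_pressure : ph ∈ (Q : Set (L2 Ω))) hq
    have h1 := hsol.error_eq hup hv
    have h2 : ⟪p - s, divg v⟫ = 0 := Submodule.starProjection_inner_eq_zero p _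
      (Q.le_topologicalClosure (Submodule.mem_map_of_mem hv))
    have h3 : ⟪divg v, ph - q⟫ = -(ν * ⟪grad u - grad uh, grad v⟫) - ⟪q - s, divg v⟫ := by
      rw [h1, real_inner_comm, ← inner_neg_left, ← inner_sub_left]
      have : ph - q = -(p - ph) - (q - s) + (p - s) := by abel
      rw [this, inner_add_left, h2, add_zero]
    have h4 : -⟪grad u - grad uh, grad v⟫ ≤ ‖grad u - grad uh‖ * ‖grad v‖ :=
      (neg_le_abs _).trans (abs_real_inner_le_norm _ _)
    have h5 : -⟪q - s, divg v⟫ ≤ ‖q - s‖ * (C * ‖grad v‖) :=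
      (neg_le_abs _).trans ((abs_real_inner_le_norm _ _).trans (by gcongr; exact hdivC v))
    rw [h3]
    nlinarith [mul_le_mul_of_nonneg_left h4 hν.le]
  have hlim : β * ‖ph - s‖ ≤ ν * ‖grad u - grad uh‖ + C * ‖s - s‖ := by
    have hclosed : IsClosed {q : L2 Ω | β * ‖ph - q‖ ≤ ν * ‖grad u - grad uh‖ + C * ‖q - s‖} :=
      isClosed_le (by fun_prop) (by fun_prop)
    exact closure_minimal happrox hclosed hsR
  rw [sub_self, norm_zero, mul_zero, add_zero] at hlim
  have htri : ‖p - ph‖ ≤ ‖ph - s‖ + ‖p - s‖ := by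
    rw [norm_sub_rev ph s, add_comm]
    exact norm_sub_le_norm_sub_add_norm_sub p s ph
  nlinarith [mul_le_mul_of_nonneg_left (htri.trans (add_le_add_right hbest _)) hβ.le]

end

end ScottVogelius

end

/-! ### Quasi-optimality -/

theorem mainTheorem2 (d : ℕ) (hd : 2 ≤ d) (Ω : Set (Vec d)) (hΩ : IsLipschitzDomain Ω)
    (ν : ℝ) (hν : 0 < ν) (f : H10 Ω →L[ℝ] ℝ) (g : H1 Ω) (hg : g ∈ H1sim Ω)
    (u : H1 Ω) (p : L2 Ω) (hup : IsWeakSolution Ω ν f g u p)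
    (𝒯 : ℕ → Triangulation Ω) (h𝒯 : ShapeRegular 𝒯) (k : ℕ)
    (β : ℝ) (hβ : 0 < β) (hinfsup : ∀ i, InfSup (𝒯 i) k β)
    (hdiv : ∀ i, divg '' (velocitySpaceZero (𝒯 i) k : Set (H1 Ω)) =
      divg '' velocitySpaceSim (𝒯 i) k)
    (I : ∀ i, H1 Ω →ₗ[ℝ] velocitySpace (𝒯 i) k) (cI : ℝ) (hcI : 0 < cI)
    (hI : ∀ i, IsQuasiInterpolation (𝒯 i) k (I i) cI)
    (P : ∀ i, H1 Ω →ₗ[ℝ] velocitySpace (𝒯 i) k) (cF : ℝ) (hcF : 0 < cF)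
    (hP : ∀ i, IsFortin (𝒯 i) k (P i) cF)
    (gh : ∀ i, velocitySpace (𝒯 i) k)
    (hghI : ∀ i, SameTrace Ω (gh i : H1 Ω) (I i g : H1 Ω))
    (hghP : ∀ i, SameTrace Ω (gh i : H1 Ω) (P i g : H1 Ω))
    (uh : ℕ → H1 Ω) (ph : ℕ → L2 Ω)
    (hsol : ∀ i, IsDiscreteSolution (𝒯 i) k ν f (gh i : H1 Ω) (uh i) (ph i)) :
    ∀ i,
      (gh i : H1 Ω) ∈ velocitySpaceSim (𝒯 i) k ∧
      uh i ∈ velocitySpaceSimDiv (𝒯 i) k ∧ divg (uh i) = 0 ∧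
      ‖grad u - grad (uh i)‖ ≤
        2 * (1 + cF) * ⨅ v : velocitySpace (𝒯 i) k, ‖grad u - grad (v : H1 Ω)‖ ∧
      β * ν⁻¹ * ‖p - ph i‖ ≤
        2 * (1 + cF) * (⨅ v : velocitySpace (𝒯 i) k, ‖grad u - grad (v : H1 Ω)‖) +
          β * ν⁻¹ * ⨅ q : pressureSpace (𝒯 i) k, ‖p - (q : L2 Ω)‖ := by
  intro i
  have ho := hΩ.isOpen
  have hb := hΩ.isBounded
  have hghsim : (gh i : H1 Ω) ∈ H1sim Ω :=
    (hghP i).mem_H1sim ho hb ((hP i).mean_preserving g hg)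
  have huhsim : uh i ∈ velocitySpaceSim (𝒯 i) k :=
    ⟨(hsol i).mem_velocity, (hsol i).boundary.mem_H1sim ho hb hghsim⟩
  have huh : divg (uh i) = 0 := divg_eq_zero_of_orthogonal ⟨_, huhsim, rfl⟩ (hsol i).mass
  have hvel : ‖grad u - grad (uh i)‖ ≤
      2 * (1 + cF) * ⨅ v : velocitySpace (𝒯 i) k, ‖grad u - grad (v : H1 Ω)‖ := by
    -- The argument gives the constant 1 + c_F; the factor 2 is then free, since the right-hand side
    -- is nonnegative.
    have h1 : ‖grad u - grad (uh i)‖ ≤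
        (1 + cF) * ⨅ v : velocitySpace (𝒯 i) k, ‖grad u - grad (v : H1 Ω)‖ := by
      rw [Real.mul_iInf_of_nonneg (by positivity)]
      exact le_ciInf fun v => norm_grad_sub_le (by omega) hΩ hν hup (hdiv i) (hP i) (hghP i)
        (hsol i) huh v
    have h2 : 0 ≤ (1 + cF) * ⨅ v : velocitySpace (𝒯 i) k, ‖grad u - grad (v : H1 Ω)‖ :=
      (norm_nonneg _).trans h1
    linarith
  refine ⟨⟨(gh i).2, hghsim⟩, ⟨huhsim, (hsol i).mass⟩, huh, hvel, ?_⟩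
  have : Nonempty (pressureSpace (𝒯 i) k) := ⟨⟨_, (hsol i).mem_pressure⟩⟩
  refine le_trans ?_ (add_le_add_left hvel _)
  -- With the velocity term moved to the left, the bound can be proved for each q separately, before
  -- the infimum over Q_h is taken.
  rw [Real.mul_iInf_of_nonneg (by positivity), ← sub_le_iff_le_add']
  refine le_ciInf fun q => ?_
  have h := norm_pressure_sub_le hν hup hβ (hinfsup i) (hdiv i) (hsol i) q
  rw [sub_le_iff_le_add']
  calc β * ν⁻¹ * ‖p - ph i‖ = ν⁻¹ * (β * ‖p - ph i‖) := by ring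
    _ ≤ ν⁻¹ * (ν * ‖grad u - grad (uh i)‖ + β * ‖p - q‖) := by gcongr
    _ = ‖grad u - grad (uh i)‖ + β * ν⁻¹ * ‖p - q‖ := by field_simp
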